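/- Let $E_0<E_1\le E_2\le\cdots$ be real numbers (the one-particle energy levels) such that, for some constants $L>0$ and $\alpha\ge 1$, $\#\{j\ge 0:E_j\le\lambda\}/(L\lambda^\alpha)\to 1$ as $\lambda\to\infty$. Let $k_B>0$ and put $$c:=\begin{cases}(L\alpha\Gamma(\alpha)\zeta(\alpha))^{1/\alpha}&\text{if }\alpha>1,\\ L&\text{if }\alpha=1,\end{cases}\qquad t_c:=\frac1{k_B c}.$$ For $n\ge 1$ and $\beta>0$, the canonical Gibbs measure for $n$ bosons at inverse temperature $\beta$ is the probability measure on the set of sequences $\mathbf n=(n_0,n_1,\ldots)$ of non-negative integers with $\sum_j n_j=n$ that gives $\mathbf n$ a mass proportional to $e^{-\beta\sum_j n_jE_j}$; its normalizing constant is finite. Fix $t>0$ and let $(N_0,N_1,\ldots)$ (depending on $n$) be drawn from this measure with $\beta=1/(k_BT)$, where $T=tn^{1/\alpha}$ if $\alpha>1$ and $T=tn/\log n$ if $\alpha=1$. Let $X_1,X_2,\ldots$ be i.i.d. exponential random variables with mean $1$ and let $$W:=\frac1c\sum_{j=1}^\infty\frac{1-X_j}{E_j-E_0}$$ whenever this series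 converges almost surely. Suppose that $t<t_c$. Then, as $n\to\infty$: - if $\alpha=1$, the series defining $W$ converges almost surely and in $L^2$, and $\dfrac{N_0-\mathbb E(N_0)}{n/\log n}\to(t/t_c)W$ in distribution; - if $1<\alpha<2$, the series defining $W$ converges almost surely and in $L^2$, and $\dfrac{N_0-\mathbb E(N_0)}{n^{1/\alpha}}\to(t/t_c)W$ in distribution; - if $\alpha=2$, $\dfrac{N_0-\mathbb E(N_0)}{\sqrt{n\log n}}\to\mathcal N\bigl(0,\,3(t/t_c)^2/\pi^2\bigr)$ in distribution; - if $\alpha>2$, $\dfrac{N_0-\mathbb E(N_0)}{\sqrt n}\to\mathcal N\bigl(0,\,(t/t_c)^\alpha\zeta(\alpha-1)/\zeta(\alpha)\bigr)$ in distribution. Here $\mathcal N(\mu,\sigma^2)$ is the normal law with mean $\mu$ and variance $\sigma^2$. -/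

import Mathlib

open MeasureTheory ProbabilityTheory Filter Topology
open scoped ENNReal

namespace BoseGas

/-- A configuration of `n` bosons: a sequence `(n₀, n₁, n₂, …)` of non-negative integers with sum
`n`, where `n_j` is the number of particles in state `j`. (A sequence of non-negative integers with
finite sum has finite support.) -/
def Config (n : ℕ) : Type := {c : ℕ →₀ ℕ // (c.sum fun _ k => k) = n}

/-- The (countable) space of configurations carries the discrete σ-algebra. -/
instance (n : ℕ) : MeasurableSpace (Config n) := ⊤

/-- The configuration with all `n` particles in the ground state. -/
noncomputable def groundConfig (n : ℕ) : Config n :=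
  ⟨Finsupp.single 0 n, by simp⟩

/-- The number `n_j` of particles in state `j`. -/
def occupation {n : ℕ} (c : Config n) (j : ℕ) : ℕ := c.1 j

/-- The energy `∑ j, n_j E_j` of a configuration. -/
noncomputable def energy (E : ℕ → ℝ) {n : ℕ} (c : Config n) : ℝ :=
  c.1.sum fun j k => (k : ℝ) * E j

/-- The Boltzmann weight `exp (-β H(c))` of a configuration. -/
noncomputable def boltzmannWeight (E : ℕ → ℝ) (n : ℕ) (β : ℝ) (c : Config n) : ℝ≥0∞ :=
  ENNReal.ofReal (Real.exp (-β * energy E c))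

/-- The partition function `∑ c, exp (-β H(c))`, possibly infinite. -/
noncomputable def partitionFunction (E : ℕ → ℝ) (n : ℕ) (β : ℝ) : ℝ≥0∞ :=
  ∑' c : Config n, boltzmannWeight E n β c

theorem tsum_boltzmannWeight_ne_zero (E : ℕ → ℝ) (n : ℕ) (β : ℝ) :
    (∑' c, boltzmannWeight E n β c) ≠ 0 := by
  intro h
  have h0 := ENNReal.tsum_eq_zero.mp h (groundConfig n)
  unfold boltzmannWeight at h0
  rw [ENNReal.ofReal_eq_zero] at h0
  exact absurd (Real.exp_pos _) (not_lt.mpr h0)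

open Classical in
/-- The canonical Gibbs measure for `n` bosons at inverse temperature `β`: the probability measure
on configurations with mass proportional to `exp (-β H(c))` at `c`. When the partition function is
infinite no such probability measure exists, and the value is the point mass at the ground
configuration by convention. -/
noncomputable def gibbs (E : ℕ → ℝ) (n : ℕ) (β : ℝ) : PMF (Config n) :=
  if h : (∑' c, boltzmannWeight E n β c) ≠ ∞ then
    PMF.normalize (boltzmannWeight E n β) (tsum_boltzmannWeight_ne_zero E n β) h
  else PMF.pure (groundConfig n)

/-- The canonical Gibbs measure as a measure. -/
noncomputable def gibbsMeasure (E : ℕ → ℝ) (n : ℕ) (β : ℝ) : Measure (Config n) :=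
  (gibbs E n β).toMeasure

instance (E : ℕ → ℝ) (n : ℕ) (β : ℝ) : IsProbabilityMeasure (gibbsMeasure E n β) :=
  PMF.toMeasure.isProbabilityMeasure _

/-- The centered ground state occupation number `N₀ - 𝔼 N₀`, the expectation being taken under
the canonical Gibbs measure. -/
noncomputable def centeredN0 (E : ℕ → ℝ) (n : ℕ) (β : ℝ) (c : Config n) : ℝ :=
  (occupation c 0 : ℝ) - ∫ c', (occupation c' 0 : ℝ) ∂(gibbsMeasure E n β)

/-- The law `#{j : E_j ≤ x} ∼ L x ^ α` as `x → ∞`. (If the set is infinite then `Set.ncard` is `0`,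
so the law forces these sets to be finite.) -/
def WeylLaw (E : ℕ → ℝ) (L α : ℝ) : Prop :=
  Tendsto (fun x : ℝ => (({j : ℕ | E j ≤ x}.ncard : ℕ) : ℝ) / (L * x ^ α)) atTop (𝓝 1)

/-- The Riemann zeta function at real arguments. -/
noncomputable def zeta (s : ℝ) : ℝ := (riemannZeta (s : ℂ)).re

/-- `L` if `α = 1`, and `(L α Γ(α) ζ(α)) ^ (1/α)` otherwise. -/
noncomputable def spectralConst (L α : ℝ) : ℝ :=
  if α = 1 then L else (L * α * Real.Gamma α * zeta α) ^ (1 / α)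

/-- The critical value `t_c`. -/
noncomputable def criticalT (kB L α : ℝ) : ℝ := 1 / (kB * spectralConst L α)

/-- The temperature `T` of the system of `n` bosons. -/
noncomputable def temperature (α t : ℝ) (n : ℕ) : ℝ :=
  if α = 1 then t * n / Real.log n else t * (n : ℝ) ^ (1 / α)

/-- The inverse temperature `β = 1 / (k_B T)` of the system of `n` bosons. -/
noncomputable def invTemp (kB α t : ℝ) (n : ℕ) : ℝ := 1 / (kB * temperature α t n)

/-- The `m`-th partial sum of the series
`W = c⁻¹ ∑_{j ≥ 1} (1 - X_j) / (E_j - E_0)`, `c = spectralConst L α`. The random variable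
`X_j` of the series, for `j ≥ 1`, is `X (j - 1)` here. -/
noncomputable def partialW {Ω : Type*} (E : ℕ → ℝ) (L α : ℝ) (X : ℕ → Ω → ℝ) (m : ℕ) (ω : Ω) : ℝ :=
  1 / spectralConst L α * ∑ j ∈ Finset.range m, (1 - X j ω) / (E (j + 1) - E 0)

/-- `W` is the sum of the series, which converges almost surely and in `L²`. -/
structure IsSeriesLimit {Ω : Type*} [MeasurableSpace Ω] (P : Measure Ω)
    (E : ℕ → ℝ) (L α : ℝ) (X : ℕ → Ω → ℝ) (W : Ω → ℝ) : Prop where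
  memLp : MemLp W 2 P
  tendsto_ae : ∀ᵐ ω ∂P, Tendsto (fun m => partialW E L α X m ω) atTop (𝓝 (W ω))
  tendsto_L2 : Tendsto (fun m => eLpNorm (partialW E L α X m - W) 2 P) atTop (𝓝 0)

end BoseGas

/-!
Write `D j = E (j + 1) - E 0`. A configuration of `n` bosons is determined by its excited part,
and the Gibbs weight only sees the energies `D j`; hence, under the Gibbs measure, the excited
occupation numbers are distributed as *independent* geometric variables `G j` with parameters `exp
(-β D j)`, conditioned on the event `∑ j, G j ≤ n`. The ground state holds the rest, so `N₀ - 𝔼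
N₀` is minus the centred total number of excited particles.

Independent exponential variables `X j` give all these geometric variables at once, at every
temperature: `G j = ⌊X j / (β D j)⌋`. The mean and variance of `∑ j, G j` are sums over `k` of the
heat trace `∑ j, exp (-k β D j)`, which Weyl's law determines as `β → 0` by an Abelian theorem.
Below the critical temperature the mean is at most `r n` with `r < 1`, and the variance is
`o(n²)`. The conditioning event therefore has probability tending to one, and conditioning changes
neither the limit law (`tendsto_charFun_gibbs`) nor, to the relevant order, the mean.

For `α < 2` the rounding error is negligible: `β (G j - 𝔼 G j)` is close to `(X j - 1) / D j` in
`L²`, the variances `1 / D j ^ 2` are summable, and the centred total multiplied by `β` converges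
in `L²` to `∑ j, (X j - 1) / D j = -c W` (`tendstoInDistribution_series`). For `α ≥ 2` these
variances are not summable and many levels contribute. The total is compound Poisson, its
characteristic function is `exp (∑ j, ∑ k ≥ 1, (exp (i k s) - 1) exp (-k β D j) / k)`, and a
second order expansion of the exponent leaves the variance, with a third order remainder that
vanishes after scaling (`tendstoInDistribution_gaussian`). Lévy's continuity theorem concludes.
-/

namespace BoseGas

/-! ### Level counting -/

/-- The number of levels of the spectrum `D` that are at most `x` (`0` if there are infinitely
many). -/
noncomputable def levelCount (D : ℕ → ℝ) (x : ℝ) : ℕ := {j | D j ≤ x}.ncard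

/-- `D` is a positive nondecreasing sequence of levels (in the application, the excitation
energies `E (j + 1) - E 0`) whose counting function is asymptotic to `L x ^ α`. -/
structure IsSpectrum (D : ℕ → ℝ) (L α : ℝ) : Prop where
  mono : Monotone D
  pos_zero : 0 < D 0
  L_pos : 0 < L
  one_le : 1 ≤ α
  law : Tendsto (fun x => (levelCount D x : ℝ) / x ^ α) atTop (𝓝 L)

namespace IsSpectrum

variable {D : ℕ → ℝ} {L α : ℝ}

lemma pos (h : IsSpectrum D L α) (j : ℕ) : 0 < D j := h.pos_zero.trans_le (h.mono (Nat.zero_le j))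

lemma α_pos (h : IsSpectrum D L α) : 0 < α := zero_lt_one.trans_le h.one_le

lemma finite (h : IsSpectrum D L α) (x : ℝ) : {j | D j ≤ x}.Finite := by
  have h1 := h.law.eventually (lt_mem_nhds h.L_pos)
  obtain ⟨y, hy, hxy⟩ := (h1.and (eventually_ge_atTop x)).exists
  have h2 : {j | D j ≤ y}.Finite := by
    refine Set.finite_of_ncard_ne_zero fun h0 => ?_
    simp [levelCount, h0] at hy
  exact h2.subset fun j hj => le_trans hj hxy

lemma levelCount_mono (h : IsSpectrum D L α) : Monotone (levelCount D) := fun _ y hxy =>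
  Set.ncard_le_ncard (fun _ hj => le_trans hj hxy) (h.finite y)

lemma levelCount_eq_zero (h : IsSpectrum D L α) {x : ℝ} (hx : x < D 0) : levelCount D x = 0 := by
  have : {j | D j ≤ x} = ∅ := by
    ext j
    simpa using hx.trans_le (h.mono (Nat.zero_le j))
  simp [levelCount, this]

lemma exists_levelCount_le (h : IsSpectrum D L α) :
    ∃ C : ℝ, 0 < C ∧ ∀ x, 0 < x → (levelCount D x : ℝ) ≤ C * x ^ α := by
  have h1 := h.law.eventually (gt_mem_nhds (lt_add_one L))
  obtain ⟨y, hy⟩ := (h1.and (eventually_ge_atTop 1)).exists_forall_of_atTop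
  have hL := h.L_pos
  refine ⟨(L + 1) + levelCount D y / (D 0) ^ α, by have := h.pos 0; positivity, fun x hx => ?_⟩
  have hxα : 0 < x ^ α := by positivity
  have hD : 0 < (D 0) ^ α := Real.rpow_pos_of_pos h.pos_zero _
  rw [add_mul]
  rcases le_total y x with hyx | hxy
  · have := (hy x hyx).1
    rw [div_lt_iff₀ hxα] at this
    have h3 : 0 ≤ levelCount D y / (D 0) ^ α * x ^ α := by positivity
    linarith
  · rcases lt_or_ge x (D 0) with hx0 | hx0
    · rw [h.levelCount_eq_zero hx0]
      simp only [Nat.cast_zero]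
      positivity
    · have h3 : (levelCount D x : ℝ) ≤ levelCount D y := by exact_mod_cast h.levelCount_mono hxy
      have h4 : (D 0) ^ α ≤ x ^ α := Real.rpow_le_rpow h.pos_zero.le hx0 h.α_pos.le
      have h5 : (levelCount D y : ℝ) ≤ levelCount D y / (D 0) ^ α * x ^ α := by
        rw [div_mul_eq_mul_div, le_div_iff₀ hD]
        gcongr
      have h6 : 0 ≤ (L + 1) * x ^ α := by positivity
      linarith

/-- The levels grow at least like `j ^ (1 / α)`. -/
lemma exists_le_mul_rpow (h : IsSpectrum D L α) :
    ∃ C : ℝ, 0 < C ∧ ∀ j : ℕ, ((j : ℝ) + 1) ≤ C * (D j) ^ α := by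
  obtain ⟨C, hC, hb⟩ := h.exists_levelCount_le
  refine ⟨C, hC, fun j => le_trans ?_ (hb (D j) (h.pos j))⟩
  have : (Finset.range (j + 1) : Set ℕ).ncard ≤ levelCount D (D j) := by
    refine Set.ncard_le_ncard (fun i hi => ?_) (h.finite _)
    simp at hi
    exact h.mono (by omega)
  rw [Set.ncard_coe_finset, Finset.card_range] at this
  exact_mod_cast this

lemma summable_inv_sq (h : IsSpectrum D L α) (hα : α < 2) : Summable fun j => 1 / (D j) ^ 2 := by
  obtain ⟨C, hC, hb⟩ := h.exists_le_mul_rpow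
  have hα0 := h.α_pos
  have h1 : Summable fun j : ℕ => C ^ (2 / α) * (1 / ((j : ℝ) + 1) ^ (2 / α)) := by
    refine Summable.mul_left _ ?_
    have h2 : 1 < 2 / α := by rw [lt_div_iff₀ hα0]; linarith
    have := (summable_nat_add_iff 1).2 (Real.summable_one_div_nat_rpow.2 h2)
    simpa using this
  refine Summable.of_nonneg_of_le (fun j => by positivity) (fun j => ?_) h1
  have hD := h.pos j
  have h3 := Real.rpow_le_rpow (by positivity) (hb j) (by positivity : 0 ≤ 2 / α)
  rw [Real.mul_rpow hC.le (by positivity), ← Real.rpow_mul hD.le, mul_div_cancel₀ _ hα0.ne',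
    Real.rpow_two] at h3
  rw [mul_one_div, div_le_div_iff₀ (by positivity) (by positivity)]
  linarith

end IsSpectrum

/-! ### The heat trace -/

/-- The heat trace `∑ j, exp (-s D_j)`. -/
noncomputable def heatTrace (D : ℕ → ℝ) (s : ℝ) : ℝ := ∑' j, Real.exp (-s * D j)

lemma lintegral_indicator_Ici_exp_neg {b : ℝ} (hb : 0 < b) :
    ∫⁻ y in Set.Ioi (0 : ℝ), (Set.Ici b).indicator (fun y => ENNReal.ofReal (Real.exp (-y))) y
      = ENNReal.ofReal (Real.exp (-b)) := by
  rw [lintegral_indicator measurableSet_Ici, Measure.restrict_restrict measurableSet_Ici,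
    Set.inter_eq_left.2 (Set.Ici_subset_Ioi.2 hb), setLIntegral_congr Ioi_ae_eq_Ici.symm,
    ← ofReal_integral_eq_lintegral_ofReal, integral_exp_neg_Ioi]
  · simpa [IntegrableOn] using exp_neg_integrableOn_Ioi b one_pos
  · exact ae_of_all _ fun y => (Real.exp_pos _).le

namespace IsSpectrum

variable {D : ℕ → ℝ} {L α : ℝ}

lemma measurable_levelCount (h : IsSpectrum D L α) :
    Measurable fun x => (levelCount D x : ℝ) :=
  Monotone.measurable fun x y hxy => by exact_mod_cast h.levelCount_mono hxy

lemma measurable_exp_neg_mul_levelCount (h : IsSpectrum D L α) (s : ℝ) :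
    Measurable fun y : ℝ => Real.exp (-y) * levelCount D (y / s) :=
  (by fun_prop : Measurable fun y : ℝ => Real.exp (-y)).mul
    (h.measurable_levelCount.comp (measurable_id.div_const s))

lemma tsum_ofReal_exp (h : IsSpectrum D L α) {s : ℝ} (hs : 0 < s) :
    ∑' j, ENNReal.ofReal (Real.exp (-s * D j))
      = ∫⁻ y in Set.Ioi (0 : ℝ), ENNReal.ofReal (Real.exp (-y) * levelCount D (y / s)) := by
  have h1 : ∀ j, ENNReal.ofReal (Real.exp (-s * D j)) = ∫⁻ y in Set.Ioi (0 : ℝ),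
      (Set.Ici (s * D j)).indicator (fun y => ENNReal.ofReal (Real.exp (-y))) y := fun j => by
    rw [lintegral_indicator_Ici_exp_neg (mul_pos hs (h.pos j)), neg_mul]
  simp_rw [h1]
  rw [← lintegral_tsum]
  · refine lintegral_congr fun y => ?_
    have h2 : ∀ j, (Set.Ici (s * D j)).indicator (fun y => ENNReal.ofReal (Real.exp (-y))) y
        = {j | D j ≤ y / s}.indicator (fun _ => ENNReal.ofReal (Real.exp (-y))) j := fun j => by
      simp only [Set.indicator, Set.mem_Ici, Set.mem_ofPred_eq, le_div_iff₀ hs, mul_comm]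
    simp_rw [h2]
    rw [← tsum_subtype, ENNReal.tsum_set_const, ← (h.finite _).cast_ncard_eq,
      ENNReal.ofReal_mul (Real.exp_pos _).le, mul_comm]
    simp [levelCount]
  · intro j
    refine Measurable.aemeasurable ?_
    exact (by fun_prop : Measurable fun y => ENNReal.ofReal (Real.exp (-y))).indicator
      measurableSet_Ici

lemma integrableOn_exp_neg_mul_rpow (h : IsSpectrum D L α) :
    IntegrableOn (fun y : ℝ => Real.exp (-y) * y ^ α) (Set.Ioi 0) := by
  have := Real.GammaIntegral_convergent (s := α + 1) (by linarith [h.α_pos])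
  simpa using this

lemma integrableOn_exp_neg_mul_levelCount (h : IsSpectrum D L α) {s : ℝ} (hs : 0 < s) :
    IntegrableOn (fun y : ℝ => Real.exp (-y) * levelCount D (y / s)) (Set.Ioi 0) := by
  obtain ⟨C, hC, hb⟩ := h.exists_levelCount_le
  refine Integrable.mono' (h.integrableOn_exp_neg_mul_rpow.const_mul (C * (1 / s) ^ α)) ?_ ?_
  · exact (h.measurable_exp_neg_mul_levelCount s).aestronglyMeasurable
  · refine (ae_restrict_iff' measurableSet_Ioi).2 (ae_of_all _ fun y (hy : 0 < y) => ?_)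
    rw [Real.norm_of_nonneg (by positivity)]
    have := hb (y / s) (by positivity)
    rw [div_eq_mul_one_div, Real.mul_rpow hy.le (by positivity)] at this
    calc _ ≤ Real.exp (-y) * (C * (y ^ α * (1 / s) ^ α)) := by
          rw [div_eq_mul_one_div]; gcongr
      _ = _ := by ring

lemma summable_exp (h : IsSpectrum D L α) {s : ℝ} (hs : 0 < s) :
    Summable fun j => Real.exp (-s * D j) := by
  have h1 := h.tsum_ofReal_exp hs
  rw [← ofReal_integral_eq_lintegral_ofReal (h.integrableOn_exp_neg_mul_levelCount hs)
    (ae_of_all _ fun y => by positivity)] at h1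
  have h2 := ENNReal.summable_toReal (h1 ▸ ENNReal.ofReal_ne_top)
  simpa [ENNReal.toReal_ofReal, (Real.exp_pos _).le] using h2

lemma heatTrace_nonneg (D : ℕ → ℝ) (s : ℝ) : 0 ≤ heatTrace D s :=
  tsum_nonneg fun _ => (Real.exp_pos _).le

lemma heatTrace_eq_integral (h : IsSpectrum D L α) {s : ℝ} (hs : 0 < s) :
    heatTrace D s = ∫ y in Set.Ioi (0 : ℝ), Real.exp (-y) * levelCount D (y / s) := by
  have h1 := h.tsum_ofReal_exp hs
  rw [← ofReal_integral_eq_lintegral_ofReal (h.integrableOn_exp_neg_mul_levelCount hs)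
    (ae_of_all _ fun y => by positivity), ← ENNReal.ofReal_tsum_of_nonneg
    (fun _ => (Real.exp_pos _).le) (h.summable_exp hs)] at h1
  exact (ENNReal.ofReal_eq_ofReal_iff (heatTrace_nonneg D s)
    (integral_nonneg fun y => by positivity)).1 h1

/-- The scaled heat trace is bounded: it is a weighted average of `levelCount D x / x ^ α`. -/
lemma exists_rpow_mul_heatTrace_le (h : IsSpectrum D L α) :
    ∃ C : ℝ, 0 < C ∧ ∀ s, 0 < s → s ^ α * heatTrace D s ≤ C := by
  obtain ⟨C, hC, hb⟩ := h.exists_levelCount_le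
  have hα := h.α_pos
  refine ⟨C * Real.Gamma (α + 1), by have := Real.Gamma_pos_of_pos (s := α + 1); positivity,
    fun s hs => ?_⟩
  rw [h.heatTrace_eq_integral hs, ← integral_const_mul, Real.Gamma_eq_integral (by positivity),
    ← integral_const_mul]
  refine setIntegral_mono_on ((h.integrableOn_exp_neg_mul_levelCount hs).const_mul _)
    ?_ measurableSet_Ioi fun y (hy : 0 < y) => ?_
  · simpa [IntegrableOn] using h.integrableOn_exp_neg_mul_rpow.const_mul C
  · have := hb (y / s) (by positivity)
    rw [Real.div_rpow hy.le hs.le] at this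
    calc s ^ α * (Real.exp (-y) * levelCount D (y / s))
        ≤ s ^ α * (Real.exp (-y) * (C * (y ^ α / s ^ α))) := by gcongr
      _ = _ := by
        have : s ^ α ≠ 0 := by positivity
        simp only [add_sub_cancel_right]
        field_simp

/-- Since the lowest level is positive, the scaled heat trace decays exponentially. -/
lemma exists_rpow_mul_heatTrace_le_exp (h : IsSpectrum D L α) :
    ∃ C : ℝ, 0 < C ∧ ∀ s, 0 < s → s ^ α * heatTrace D s ≤ C * Real.exp (-(D 0 / 2) * s) := by
  obtain ⟨C, hC, hb⟩ := h.exists_rpow_mul_heatTrace_le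
  refine ⟨2 ^ α * C, by positivity, fun s hs => ?_⟩
  have h1 : heatTrace D s ≤ Real.exp (-(D 0 / 2) * s) * heatTrace D (s / 2) := by
    unfold heatTrace
    rw [← tsum_mul_left]
    refine (h.summable_exp hs).tsum_le_tsum (fun j => ?_)
      ((h.summable_exp (by positivity : 0 < s / 2)).mul_left _)
    rw [← Real.exp_add, Real.exp_le_exp]
    nlinarith [h.mono (Nat.zero_le j)]
  have h2 := hb (s / 2) (by positivity)
  rw [Real.div_rpow hs.le (by norm_num)] at h2
  calc s ^ α * heatTrace D s
      ≤ s ^ α * (Real.exp (-(D 0 / 2) * s) * heatTrace D (s / 2)) := by gcongr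
    _ = 2 ^ α * Real.exp (-(D 0 / 2) * s) * (s ^ α / 2 ^ α * heatTrace D (s / 2)) := by
      have : (2 : ℝ) ^ α ≠ 0 := by positivity
      field_simp
    _ ≤ 2 ^ α * Real.exp (-(D 0 / 2) * s) * C := by gcongr
    _ = _ := by ring

/-- Abelian theorem: the counting law yields the small-time behaviour of the heat trace. -/
lemma tendsto_rpow_mul_heatTrace (h : IsSpectrum D L α) :
    Tendsto (fun s => s ^ α * heatTrace D s) (𝓝[>] 0) (𝓝 (L * Real.Gamma (α + 1))) := by
  obtain ⟨C, hC, hb⟩ := h.exists_levelCount_le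
  have hα := h.α_pos
  have h1 : Tendsto (fun s => ∫ y in Set.Ioi (0 : ℝ),
      s ^ α * (Real.exp (-y) * levelCount D (y / s))) (𝓝[>] 0)
      (𝓝 (∫ y in Set.Ioi (0 : ℝ), L * (Real.exp (-y) * y ^ α))) := by
    refine tendsto_integral_filter_of_dominated_convergence
      (fun y => C * (Real.exp (-y) * y ^ α)) ?_ ?_ (h.integrableOn_exp_neg_mul_rpow.const_mul C) ?_
    · filter_upwards with s
      exact ((h.measurable_exp_neg_mul_levelCount s).const_mul _).aestronglyMeasurable
    · filter_upwards [self_mem_nhdsWithin] with s (hs : 0 < s)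
      refine (ae_restrict_iff' measurableSet_Ioi).2 (ae_of_all _ fun y (hy : 0 < y) => ?_)
      rw [Real.norm_of_nonneg (by positivity)]
      have := hb (y / s) (by positivity)
      rw [Real.div_rpow hy.le hs.le] at this
      calc s ^ α * (Real.exp (-y) * levelCount D (y / s))
          ≤ s ^ α * (Real.exp (-y) * (C * (y ^ α / s ^ α))) := by gcongr
        _ = _ := by
          have : s ^ α ≠ 0 := by positivity
          field_simp
    · refine (ae_restrict_iff' measurableSet_Ioi).2 (ae_of_all _ fun y (hy : 0 < y) => ?_)
      have h2 : Tendsto (fun s => y / s) (𝓝[>] 0) atTop :=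
        (tendsto_inv_nhdsGT_zero (𝕜 := ℝ)).const_mul_atTop hy
      have h3 := (h.law.comp h2).mul_const (Real.exp (-y) * y ^ α)
      refine h3.congr' ?_
      filter_upwards [self_mem_nhdsWithin] with s (hs : 0 < s)
      have : s ^ α ≠ 0 := by positivity
      have : y ^ α ≠ 0 := by positivity
      simp only [Function.comp, Real.div_rpow hy.le hs.le]
      field_simp
  rw [integral_const_mul] at h1
  rw [Real.Gamma_eq_integral (by positivity)]
  simp only [add_sub_cancel_right]
  refine h1.congr' ?_
  filter_upwards [self_mem_nhdsWithin] with s (hs : 0 < s)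
  rw [h.heatTrace_eq_integral hs, ← integral_const_mul]

end IsSpectrum

/-! ### Sums of the heat trace over multiples of the inverse temperature -/

lemma zeta_eq_tsum {p : ℝ} (hp : 1 < p) : zeta p = ∑' k : ℕ, 1 / ((k : ℝ) + 1) ^ p := by
  have h1 : (riemannZeta (p : ℂ)) = ((∑' k : ℕ, 1 / ((k : ℝ) + 1) ^ p : ℝ) : ℂ) := by
    rw [zeta_eq_tsum_one_div_nat_add_one_cpow (by simpa using hp), Complex.ofReal_tsum]
    refine tsum_congr fun k => ?_
    rw [Complex.ofReal_div, Complex.ofReal_cpow (by positivity)]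
    simp
  rw [zeta, h1, Complex.ofReal_re]

lemma summable_one_div_add_one_rpow {p : ℝ} (hp : 1 < p) :
    Summable fun k : ℕ => 1 / ((k : ℝ) + 1) ^ p := by
  simpa using (summable_nat_add_iff 1).2 (Real.summable_one_div_nat_rpow.2 hp)

lemma zeta_pos {p : ℝ} (hp : 1 < p) : 0 < zeta p := by
  rw [zeta_eq_tsum hp]
  exact (summable_one_div_add_one_rpow hp).tsum_pos (fun k => by positivity) 0 (by simp)

section weighted

variable {g : ℝ → ℝ} {ℓ C a : ℝ}

lemma tendsto_tsum_div_rpow (hg : ∀ s, 0 < s → |g s| ≤ C) (h0 : Tendsto g (𝓝[>] 0) (𝓝 ℓ))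
    {p : ℝ} (hp : 1 < p) :
    Tendsto (fun β : ℝ => ∑' k : ℕ, g (((k : ℝ) + 1) * β) / ((k : ℝ) + 1) ^ p) (𝓝[>] 0)
      (𝓝 (ℓ * zeta p)) := by
  rw [zeta_eq_tsum hp, ← tsum_mul_left]
  refine tendsto_tsum_of_dominated_convergence
    (bound := fun k : ℕ => C * (1 / ((k : ℝ) + 1) ^ p))
    ((summable_one_div_add_one_rpow hp).mul_left C) (fun k => ?_) ?_
  · have h1 : Tendsto (fun β : ℝ => ((k : ℝ) + 1) * β) (𝓝[>] 0) (𝓝[>] 0) := by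
      refine tendsto_nhdsWithin_iff.2 ⟨?_, ?_⟩
      · have : Tendsto (fun β : ℝ => ((k : ℝ) + 1) * β) (𝓝 0) (𝓝 (((k : ℝ) + 1) * 0)) :=
          tendsto_id.const_mul _
        rw [mul_zero] at this
        exact this.mono_left nhdsWithin_le_nhds
      · filter_upwards [self_mem_nhdsWithin] with β (hβ : 0 < β)
        exact mul_pos (by positivity) hβ
    rw [mul_one_div]
    exact (h0.comp h1).div_const _
  · filter_upwards [self_mem_nhdsWithin] with β (hβ : 0 < β)
    intro k
    rw [norm_div, Real.norm_eq_abs, Real.norm_of_nonneg (by positivity), mul_one_div]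
    gcongr
    exact hg _ (by positivity)

lemma hasSum_exp_div (ha : 0 < a) {β : ℝ} (hβ : 0 < β) :
    HasSum (fun k : ℕ => Real.exp (-a * (((k : ℝ) + 1) * β)) / ((k : ℝ) + 1))
      (-Real.log (1 - Real.exp (-a * β))) := by
  have h1 : |Real.exp (-a * β)| < 1 := by
    rw [abs_of_pos (Real.exp_pos _), Real.exp_lt_one_iff]
    nlinarith [mul_pos ha hβ]
  refine (Real.hasSum_pow_div_log_of_abs_lt_one h1).congr_fun fun k => ?_
  rw [← Real.exp_nat_mul]
  push_cast
  ring_nf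

lemma hasSum_exp_succ (ha : 0 < a) {β : ℝ} (hβ : 0 < β) :
    HasSum (fun k : ℕ => Real.exp (-a * (((k : ℝ) + 1) * β)))
      (1 / (Real.exp (a * β) - 1)) := by
  have h1 : Real.exp (-a * β) < 1 := by
    rw [Real.exp_lt_one_iff]
    nlinarith [mul_pos ha hβ]
  have h2 := (hasSum_geometric_of_lt_one (Real.exp_pos _).le h1).mul_left (Real.exp (-a * β))
  have h3 : 1 / (Real.exp (a * β) - 1) = Real.exp (-a * β) * (1 - Real.exp (-a * β))⁻¹ := by
    have h4 : 1 < Real.exp (a * β) := Real.one_lt_exp_iff.2 (mul_pos ha hβ)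
    have h5 : Real.exp (a * β) - 1 ≠ 0 := by linarith
    rw [neg_mul, Real.exp_neg]
    field_simp
  rw [h3]
  refine h2.congr_fun fun k => ?_
  rw [← Real.exp_nat_mul, ← Real.exp_add]
  ring_nf

lemma one_div_exp_sub_one_le {x : ℝ} (hx : 0 < x) : 1 / (Real.exp x - 1) ≤ 1 / x :=
  one_div_le_one_div_of_le hx (by linarith [Real.add_one_le_exp x])

lemma tendsto_log_inv_nhdsGT : Tendsto (fun β : ℝ => Real.log (1 / β)) (𝓝[>] 0) atTop := by
  simp_rw [one_div]
  exact Real.tendsto_log_atTop.comp tendsto_inv_nhdsGT_zero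

lemma tendsto_neg_log_one_sub_exp_div (ha : 0 < a) :
    Tendsto (fun β : ℝ => -Real.log (1 - Real.exp (-a * β)) / Real.log (1 / β)) (𝓝[>] 0)
      (𝓝 1) := by
  have h1 : HasDerivAt (fun β : ℝ => 1 - Real.exp (-a * β)) a 0 := by
    have := (((hasDerivAt_id (0 : ℝ)).const_mul (-a)).exp).const_sub 1
    simpa using this
  have h2 := (hasDerivAt_iff_tendsto_slope.1 h1).mono_left
    (nhdsWithin_mono _ (fun x (hx : 0 < x) => (ne_of_gt hx : x ≠ 0)))
  have h3 : Tendsto (fun β : ℝ => Real.log ((1 - Real.exp (-a * β)) / β)) (𝓝[>] 0)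
      (𝓝 (Real.log a)) := by
    refine Tendsto.log ?_ ha.ne'
    refine h2.congr fun β => ?_
    simp [slope_def_field]
  have h4 := (h3.div_atTop tendsto_log_inv_nhdsGT).const_sub 1
  rw [sub_zero] at h4
  refine h4.congr' ?_
  filter_upwards [self_mem_nhdsWithin, tendsto_log_inv_nhdsGT.eventually_gt_atTop 0]
    with β (hβ : 0 < β) hl
  have h5 : 0 < 1 - Real.exp (-a * β) := by
    have : Real.exp (-a * β) < 1 := by
      rw [Real.exp_lt_one_iff]
      nlinarith [mul_pos ha hβ]
    linarith
  rw [Real.log_div h5.ne' hβ.ne', eq_div_iff hl.ne', sub_mul, div_mul_cancel₀ _ hl.ne',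
    one_div, Real.log_inv]
  ring

lemma summable_div_of_le_exp (ha : 0 < a) (hg : ∀ s, 0 < s → |g s| ≤ C * Real.exp (-a * s))
    {β : ℝ} (hβ : 0 < β) :
    Summable fun k : ℕ => g (((k : ℝ) + 1) * β) / ((k : ℝ) + 1) := by
  refine Summable.of_norm_bounded ((hasSum_exp_div ha hβ).summable.mul_left C) fun k => ?_
  rw [norm_div, Real.norm_eq_abs, Real.norm_of_nonneg (by positivity), ← mul_div_assoc]
  gcongr
  exact hg _ (by positivity)

/-- The boundary case of `tendsto_tsum_div_rpow`: the harmonic sum of `g` over the multiples of `β`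
grows like `g (0+) log (1 / β)`. The comparison sum `∑ exp (-a k β) / k` is explicit. -/
lemma tendsto_tsum_div_div_log (ha : 0 < a) (hg : ∀ s, 0 < s → |g s| ≤ C * Real.exp (-a * s))
    (h0 : Tendsto g (𝓝[>] 0) (𝓝 ℓ)) :
    Tendsto (fun β : ℝ => (∑' k : ℕ, g (((k : ℝ) + 1) * β) / ((k : ℝ) + 1)) / Real.log (1 / β))
      (𝓝[>] 0) (𝓝 ℓ) := by
  set Λ : ℝ → ℝ := fun β => -Real.log (1 - Real.exp (-a * β)) with hΛ
  have hΛtop : Tendsto Λ (𝓝[>] 0) atTop := by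
    have := (tendsto_neg_log_one_sub_exp_div ha).pos_mul_atTop one_pos tendsto_log_inv_nhdsGT
    refine this.congr' ?_
    filter_upwards [tendsto_log_inv_nhdsGT.eventually_gt_atTop 0] with β hl
    rw [div_mul_cancel₀ _ hl.ne']
  suffices H : Tendsto (fun β : ℝ =>
      (∑' k : ℕ, g (((k : ℝ) + 1) * β) / ((k : ℝ) + 1)) / Λ β) (𝓝[>] 0) (𝓝 ℓ) by
    have := H.mul (tendsto_neg_log_one_sub_exp_div ha)
    rw [mul_one] at this
    refine this.congr' ?_
    filter_upwards [hΛtop.eventually_gt_atTop 0] with β hl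
    exact div_mul_div_cancel₀ hl.ne'
  rw [Metric.tendsto_nhds]
  intro ε hε
  -- near `0` the difference `g s - ℓ exp (-a s)` is small, elsewhere it is `O(s exp (-a s))`
  obtain ⟨B, hB, hr⟩ : ∃ B, 0 < B ∧ ∀ s, 0 < s →
      |g s - ℓ * Real.exp (-a * s)| ≤ (ε / 2 + B * s) * Real.exp (-a * s) := by
    have h1 : Tendsto (fun s => g s * Real.exp (a * s) - ℓ) (𝓝[>] 0) (𝓝 (ℓ * 1 - ℓ)) := by
      refine (h0.mul ?_).sub_const ℓ
      have : Continuous fun s : ℝ => Real.exp (a * s) := by fun_prop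
      have := this.tendsto 0
      rw [mul_zero, Real.exp_zero] at this
      exact this.mono_left nhdsWithin_le_nhds
    rw [mul_one, sub_self] at h1
    have h2 := h1.abs.eventually (gt_mem_nhds (by simpa using half_pos hε : |(0 : ℝ)| < ε / 2))
    obtain ⟨δ, hδ, hs⟩ := mem_nhdsGT_iff_exists_Ioo_subset.1 h2
    have hδ0 : (0 : ℝ) < δ := hδ
    have hC : 0 ≤ C := by
      have := (abs_nonneg _).trans (hg 1 one_pos)
      exact nonneg_of_mul_nonneg_left this (Real.exp_pos _)
    refine ⟨(C + |ℓ| + 1) / δ, by positivity, fun s hs0 => ?_⟩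
    have hE := Real.exp_pos (-a * s)
    rcases lt_or_ge s δ with hlt | hge
    · have h3 : |g s * Real.exp (a * s) - ℓ| < ε / 2 := hs ⟨hs0, hlt⟩
      have h4 : g s - ℓ * Real.exp (-a * s)
          = (g s * Real.exp (a * s) - ℓ) * Real.exp (-a * s) := by
        rw [sub_mul, mul_assoc, ← Real.exp_add]
        simp
      rw [h4, abs_mul, abs_of_pos hE]
      gcongr
      have : 0 ≤ (C + |ℓ| + 1) / δ * s := by positivity
      linarith
    · calc |g s - ℓ * Real.exp (-a * s)| ≤ |g s| + |ℓ * Real.exp (-a * s)| := abs_sub _ _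
        _ ≤ C * Real.exp (-a * s) + |ℓ| * Real.exp (-a * s) := by
          rw [abs_mul, abs_of_pos hE]
          gcongr
          exact hg s hs0
        _ = (C + |ℓ|) * Real.exp (-a * s) := by ring
        _ ≤ _ := by
          refine mul_le_mul_of_nonneg_right ?_ hE.le
          have : C + |ℓ| + 1 ≤ (C + |ℓ| + 1) / δ * s := by
            rw [div_mul_eq_mul_div, le_div_iff₀ hδ0]
            gcongr
          linarith
  filter_upwards [self_mem_nhdsWithin, hΛtop.eventually_gt_atTop 0,
    hΛtop.eventually_gt_atTop (2 * (B / a) / ε)] with β (hβ : 0 < β) hΛ0 hΛ1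
  rw [Real.dist_eq]
  have hs1 := (hasSum_exp_div ha hβ)
  have hs2 := (hasSum_exp_succ ha hβ)
  have h1 : (∑' k : ℕ, g (((k : ℝ) + 1) * β) / ((k : ℝ) + 1)) - ℓ * Λ β
      = ∑' k : ℕ, (g (((k : ℝ) + 1) * β) - ℓ * Real.exp (-a * (((k : ℝ) + 1) * β)))
        / ((k : ℝ) + 1) := by
    rw [show Λ β = _ from hs1.tsum_eq.symm, ← tsum_mul_left,
      ← (summable_div_of_le_exp ha hg hβ).tsum_sub (hs1.summable.mul_left ℓ)]
    refine tsum_congr fun k => ?_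
    ring
  have h2 : |∑' k : ℕ, (g (((k : ℝ) + 1) * β) - ℓ * Real.exp (-a * (((k : ℝ) + 1) * β)))
        / ((k : ℝ) + 1)| ≤ ε / 2 * Λ β + B * β * (1 / (Real.exp (a * β) - 1)) := by
    have hs3 := (hs1.mul_left (ε / 2)).add (hs2.mul_left (B * β))
    rw [← Real.norm_eq_abs]
    refine tsum_of_norm_bounded hs3 fun k => ?_
    rw [norm_div, Real.norm_eq_abs, Real.norm_of_nonneg (by positivity)]
    have hk : (0 : ℝ) < (k : ℝ) + 1 := by positivity
    rw [div_le_iff₀ hk]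
    refine (hr _ (mul_pos hk hβ)).trans (le_of_eq ?_)
    field_simp
  have h3 : B * β * (1 / (Real.exp (a * β) - 1)) ≤ B / a := by
    calc _ ≤ B * β * (1 / (a * β)) := by
          gcongr B * β * ?_
          exact one_div_exp_sub_one_le (mul_pos ha hβ)
      _ = _ := by field_simp
  have h4 : (∑' k : ℕ, g (((k : ℝ) + 1) * β) / ((k : ℝ) + 1)) / Λ β - ℓ
      = ((∑' k : ℕ, g (((k : ℝ) + 1) * β) / ((k : ℝ) + 1)) - ℓ * Λ β) / Λ β := by
    rw [sub_div, mul_div_cancel_right₀ _ hΛ0.ne']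
  rw [h4, abs_div, abs_of_pos hΛ0, div_lt_iff₀ hΛ0, h1]
  rw [div_lt_iff₀ hε] at hΛ1
  nlinarith

end weighted

namespace IsSpectrum

variable {D : ℕ → ℝ} {L α : ℝ}

lemma heatTrace_mul_rpow_eq {β x : ℝ} (hβ : 0 < β) (hx : 0 < x) (r : ℝ) :
    β ^ α * (x ^ r * heatTrace D (x * β))
      = ((x * β) ^ α * heatTrace D (x * β)) / x ^ (α - r) := by
  rw [Real.mul_rpow hx.le hβ.le, Real.rpow_sub hx]
  have : x ^ α ≠ 0 := by positivity
  have : x ^ r ≠ 0 := by positivity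
  field_simp

lemma abs_scaled_le (h : IsSpectrum D L α) :
    ∃ C : ℝ, 0 < C ∧ ∀ s, 0 < s → |s ^ α * heatTrace D s| ≤ C * Real.exp (-(D 0 / 2) * s) := by
  obtain ⟨C, hC, hb⟩ := h.exists_rpow_mul_heatTrace_le_exp
  refine ⟨C, hC, fun s hs => ?_⟩
  have := heatTrace_nonneg D s
  rw [abs_of_nonneg (by positivity)]
  exact hb s hs

/-- `∑ₖ k ^ r K(kβ) ~ L Γ(α + 1) ζ(α - r) β ^ (-α)` for `r < α - 1`. -/
lemma tendsto_rpow_mul_tsum (h : IsSpectrum D L α) (r : ℝ) (hr : 1 < α - r) :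
    Tendsto (fun β : ℝ => β ^ α * ∑' k : ℕ, ((k : ℝ) + 1) ^ r * heatTrace D (((k : ℝ) + 1) * β))
      (𝓝[>] 0) (𝓝 (L * Real.Gamma (α + 1) * zeta (α - r))) := by
  obtain ⟨C, hC, hb⟩ := h.abs_scaled_le
  have hb' : ∀ s, 0 < s → |s ^ α * heatTrace D s| ≤ C := fun s hs => by
    refine (hb s hs).trans (mul_le_of_le_one_right hC.le ?_)
    rw [Real.exp_le_one_iff]
    nlinarith [h.pos_zero]
  refine (tendsto_tsum_div_rpow hb' h.tendsto_rpow_mul_heatTrace hr).congr' ?_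
  filter_upwards [self_mem_nhdsWithin] with β (hβ : 0 < β)
  rw [← tsum_mul_left]
  exact tsum_congr fun k => (heatTrace_mul_rpow_eq hβ (by positivity) r).symm

/-- `∑ₖ k ^ (α - 1) K(kβ) ~ L Γ(α + 1) β ^ (-α) log (1 / β)`. -/
lemma tendsto_rpow_mul_tsum_div_log (h : IsSpectrum D L α) (r : ℝ) (hr : α - r = 1) :
    Tendsto (fun β : ℝ => β ^ α * (∑' k : ℕ, ((k : ℝ) + 1) ^ r *
      heatTrace D (((k : ℝ) + 1) * β)) / Real.log (1 / β))
      (𝓝[>] 0) (𝓝 (L * Real.Gamma (α + 1))) := by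
  obtain ⟨C, hC, hb⟩ := h.abs_scaled_le
  refine (tendsto_tsum_div_div_log (half_pos h.pos_zero) hb h.tendsto_rpow_mul_heatTrace).congr' ?_
  filter_upwards [self_mem_nhdsWithin] with β (hβ : 0 < β)
  rw [← tsum_mul_left]
  congr 1
  refine tsum_congr fun k => ?_
  have := heatTrace_mul_rpow_eq (D := D) (α := α) hβ (by positivity : (0 : ℝ) < (k : ℝ) + 1) r
  rw [hr, Real.rpow_one] at this
  exact this.symm

lemma summable_pow_mul_heatTrace (h : IsSpectrum D L α) (r : ℕ) {β : ℝ} (hβ : 0 < β) :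
    Summable fun k : ℕ => ((k : ℝ) + 1) ^ r * heatTrace D (((k : ℝ) + 1) * β) := by
  obtain ⟨C, hC, hb⟩ := h.abs_scaled_le
  have hρ : ‖Real.exp (-(D 0 / 2) * β)‖ < 1 := by
    rw [Real.norm_of_nonneg (Real.exp_pos _).le, Real.exp_lt_one_iff]
    nlinarith [mul_pos h.pos_zero hβ]
  have h0 : Summable fun k : ℕ =>
      ((k + 1 : ℕ) : ℝ) ^ r * Real.exp (-(D 0 / 2) * β) ^ (k + 1) :=
    (summable_nat_add_iff (f := fun k : ℕ => (k : ℝ) ^ r * Real.exp (-(D 0 / 2) * β) ^ k) 1).2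
      (summable_pow_mul_geometric_of_norm_lt_one r hρ)
  have h1 := h0.mul_left (C / β ^ α)
  refine Summable.of_nonneg_of_le (fun k => ?_) (fun k => ?_) h1
  · have := heatTrace_nonneg D (((k : ℝ) + 1) * β)
    positivity
  · have hk : (1 : ℝ) ≤ (k : ℝ) + 1 := by linarith [(Nat.cast_nonneg k : (0 : ℝ) ≤ k)]
    have h2 := (le_abs_self _).trans (hb (((k : ℝ) + 1) * β) (by positivity))
    have h3 : β ^ α ≤ (((k : ℝ) + 1) * β) ^ α := by
      refine Real.rpow_le_rpow hβ.le ?_ h.α_pos.le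
      nlinarith
    have h4 : heatTrace D (((k : ℝ) + 1) * β)
        ≤ C / β ^ α * Real.exp (-(D 0 / 2) * (((k : ℝ) + 1) * β)) := by
      rw [div_mul_eq_mul_div, le_div_iff₀ (by positivity), mul_comm]
      refine le_trans ?_ h2
      have := heatTrace_nonneg D (((k : ℝ) + 1) * β)
      gcongr
    rw [← Real.exp_nat_mul]
    push_cast
    calc _ ≤ ((k : ℝ) + 1) ^ r * (C / β ^ α * Real.exp (-(D 0 / 2) * (((k : ℝ) + 1) * β))) := by
          gcongr
      _ = _ := by ring_nf

/-- The third-order error term of the cumulant expansion. -/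
lemma exists_tsum_sq_mul_heatTrace_le (h : IsSpectrum D L α) (hα : 2 ≤ α) :
    ∃ C : ℝ, 0 < C ∧ ∀ β, 0 < β →
      β ^ α * β * ∑' k : ℕ, ((k : ℝ) + 1) ^ 2 * heatTrace D (((k : ℝ) + 1) * β) ≤ C := by
  obtain ⟨C, hC, hb⟩ := h.abs_scaled_le
  have ha := half_pos h.pos_zero
  refine ⟨C * (1 / (D 0 / 2)), by positivity, fun β hβ => ?_⟩
  have hs := hasSum_exp_succ ha hβ
  have h1 : β ^ α * ∑' k : ℕ, ((k : ℝ) + 1) ^ 2 * heatTrace D (((k : ℝ) + 1) * β)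
      ≤ C * (1 / (Real.exp (D 0 / 2 * β) - 1)) := by
    rw [← hs.tsum_eq, ← tsum_mul_left, ← tsum_mul_left]
    refine ((h.summable_pow_mul_heatTrace 2 hβ).mul_left _).tsum_le_tsum (fun k => ?_)
      (hs.summable.mul_left C)
    have hk : (0 : ℝ) < (k : ℝ) + 1 := by positivity
    have h2 := heatTrace_mul_rpow_eq (D := D) (α := α) hβ hk 2
    rw [Real.rpow_two] at h2
    rw [h2]
    refine (div_le_self ?_ ?_).trans ((le_abs_self _).trans (hb _ (by positivity)))
    · have := heatTrace_nonneg D (((k : ℝ) + 1) * β)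
      positivity
    · refine Real.one_le_rpow ?_ (by linarith)
      linarith [(Nat.cast_nonneg k : (0 : ℝ) ≤ k)]
  calc _ = β * (β ^ α * ∑' k : ℕ, ((k : ℝ) + 1) ^ 2 * heatTrace D (((k : ℝ) + 1) * β)) := by ring
    _ ≤ β * (C * (1 / (Real.exp (D 0 / 2 * β) - 1))) := by gcongr
    _ ≤ β * (C * (1 / (D 0 / 2 * β))) := by
      gcongr β * (C * ?_)
      exact one_div_exp_sub_one_le (by positivity)
    _ = _ := by field_simp

end IsSpectrum

/-! ### Series of independent centred random variables -/

section series

variable {Ω : Type*} [MeasurableSpace Ω] {P : Measure Ω}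

lemma eLpNorm_two_eq_sqrt {f : Ω → ℝ} (hf : MemLp f 2 P) :
    eLpNorm f 2 P = ENNReal.ofReal √(∫ ω, (f ω) ^ 2 ∂P) := by
  rw [hf.eLpNorm_eq_integral_rpow_norm two_ne_zero ENNReal.ofNat_ne_top]
  simp [Real.sqrt_eq_rpow]

lemma integral_sq_le_of_eLpNorm_le {f : Ω → ℝ} (hf : MemLp f 2 P) {B : ℝ} (hB : 0 ≤ B)
    (h : eLpNorm f 2 P ≤ ENNReal.ofReal √B) : ∫ ω, (f ω) ^ 2 ∂P ≤ B := by
  rw [eLpNorm_two_eq_sqrt hf, ENNReal.ofReal_le_ofReal_iff (Real.sqrt_nonneg _)] at h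
  exact (Real.sqrt_le_sqrt_iff hB).1 h

/-- Independent, centred, square-integrable random variables. -/
structure IsCentredSeq (Y : ℕ → Ω → ℝ) (P : Measure Ω) : Prop where
  meas : ∀ j, Measurable (Y j)
  memLp : ∀ j, MemLp (Y j) 2 P
  indep : iIndepFun Y P
  mean : ∀ j, ∫ ω, Y j ω ∂P = 0

variable {Y : ℕ → Ω → ℝ}

lemma IsCentredSeq.memLp_sum (hY : IsCentredSeq Y P) (s : Finset ℕ) :
    MemLp (fun ω => ∑ j ∈ s, Y j ω) 2 P :=
  memLp_finsetSum s fun j _ => hY.memLp j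

variable [IsProbabilityMeasure P]

lemma IsCentredSeq.integral_sum_sq (hY : IsCentredSeq Y P) (s : Finset ℕ) :
    ∫ ω, (∑ j ∈ s, Y j ω) ^ 2 ∂P = ∑ j ∈ s, ∫ ω, (Y j ω) ^ 2 ∂P := by
  have h1 := IndepFun.variance_sum (s := s) (fun j _ => hY.memLp j)
    (fun i _ j _ hij => hY.indep.indepFun hij)
  have h2 : ∀ j, variance (Y j) P = ∫ ω, (Y j ω) ^ 2 ∂P := fun j =>
    variance_of_integral_eq_zero (hY.meas j).aemeasurable (hY.mean j)
  have h3 : (∑ j ∈ s, Y j) = fun ω => ∑ j ∈ s, Y j ω := by ext; simp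
  rw [h3, variance_of_integral_eq_zero (hY.memLp_sum s).aemeasurable] at h1
  · simp_rw [← h2]; exact h1
  · rw [integral_finsetSum _ fun j _ => (hY.memLp j).integrable one_le_two]
    simp [hY.mean]

/-- Fatou: the `L²` norm of an almost sure sum of independent centred variables is controlled by
the sum of the variances. -/
lemma IsCentredSeq.eLpNorm_lim_le (hY : IsCentredSeq Y P) {B : ℝ}
    (hB : ∀ m, ∑ j ∈ Finset.range m, ∫ ω, (Y j ω) ^ 2 ∂P ≤ B) {Z : Ω → ℝ}
    (hZ : ∀ᵐ ω ∂P, Tendsto (fun m => ∑ j ∈ Finset.range m, Y j ω) atTop (𝓝 (Z ω))) :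
    MemLp Z 2 P ∧ eLpNorm Z 2 P ≤ ENNReal.ofReal √B := by
  have h1 := Lp.eLpNorm_lim_le_liminf_eLpNorm (p := 2)
    (fun m => (hY.memLp_sum (Finset.range m)).1) Z hZ
  have h2 : ∀ m, eLpNorm (fun ω => ∑ j ∈ Finset.range m, Y j ω) 2 P ≤ ENNReal.ofReal √B :=
    fun m => by
      rw [eLpNorm_two_eq_sqrt (hY.memLp_sum _), hY.integral_sum_sq]
      exact ENNReal.ofReal_le_ofReal (Real.sqrt_le_sqrt (hB m))
  have h3 : eLpNorm Z 2 P ≤ ENNReal.ofReal √B := by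
    refine h1.trans ?_
    refine (liminf_le_liminf (Eventually.of_forall h2)).trans ?_
    rw [liminf_const]
  refine ⟨⟨aestronglyMeasurable_of_tendsto_ae atTop
    (fun m => (hY.memLp_sum (Finset.range m)).1) hZ, h3.trans_lt ENNReal.ofReal_lt_top⟩, h3⟩

lemma IsCentredSeq.integral_lim_sq_le (hY : IsCentredSeq Y P) {B : ℝ}
    (hB : ∀ m, ∑ j ∈ Finset.range m, ∫ ω, (Y j ω) ^ 2 ∂P ≤ B) {Z : Ω → ℝ}
    (hZ : ∀ᵐ ω ∂P, Tendsto (fun m => ∑ j ∈ Finset.range m, Y j ω) atTop (𝓝 (Z ω))) :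
    ∫ ω, (Z ω) ^ 2 ∂P ≤ B := by
  obtain ⟨h1, h2⟩ := hY.eLpNorm_lim_le hB hZ
  exact integral_sq_le_of_eLpNorm_le h1 (by simpa using hB 0) h2

/-- Kolmogorov's convergence criterion: if the variances are summable, the series converges almost
surely, by the martingale convergence theorem. -/
lemma IsCentredSeq.exists_ae_tendsto (hY : IsCentredSeq Y P)
    (hs : Summable fun j => ∫ ω, (Y j ω) ^ 2 ∂P) :
    ∃ Z : Ω → ℝ, ∀ᵐ ω ∂P, Tendsto (fun m => ∑ j ∈ Finset.range m, Y j ω) atTop (𝓝 (Z ω)) := by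
  have hsm : ∀ j, StronglyMeasurable (Y j) := fun j => (hY.meas j).stronglyMeasurable
  set ℱ := Filtration.natural Y hsm with hℱ
  have hadp : ∀ i j, i ≤ j → StronglyMeasurable[ℱ j] (Y i) := fun i j hij =>
    ((Filtration.stronglyAdapted_natural hsm) i).mono (ℱ.mono hij)
  have hint : ∀ j, Integrable (Y j) P := fun j => (hY.memLp j).integrable one_le_two
  have hsad : StronglyAdapted ℱ (fun n ω => ∑ j ∈ Finset.range (n + 1), Y j ω) := fun n => by
    refine Finset.stronglyMeasurable_fun_sum _ fun j hj => hadp j n ?_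
    rw [Finset.mem_range] at hj
    omega
  have hmart : Martingale (fun n ω => ∑ j ∈ Finset.range (n + 1), Y j ω) ℱ P := by
    refine martingale_nat hsad (fun n => integrable_finsetSum _ fun j _ => hint j) fun n => ?_
    have h1 : P[Y (n + 1) | ℱ n] =ᵐ[P] fun _ => ∫ ω, Y (n + 1) ω ∂P :=
      hY.indep.condExp_natural_ae_eq_of_lt hsm (Nat.lt_succ_self n)
    have h2 : (fun ω => ∑ j ∈ Finset.range (n + 1 + 1), Y j ω)
        = (fun ω => ∑ j ∈ Finset.range (n + 1), Y j ω) + Y (n + 1) := by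
      ext ω; simp [Finset.sum_range_succ]
    have h3 := condExp_add (μ := P) (integrable_finsetSum (Finset.range (n + 1))
      fun j _ => hint j) (hint (n + 1)) (ℱ n)
    have h4 : P[(fun ω => ∑ j ∈ Finset.range (n + 1), Y j ω) | ℱ n]
        = fun ω => ∑ j ∈ Finset.range (n + 1), Y j ω :=
      condExp_of_stronglyMeasurable (ℱ.le n) (hsad n)
        (integrable_finsetSum (Finset.range (n + 1)) fun j _ => hint j)
    rw [h2]
    filter_upwards [h1, h3] with ω h1 h3
    rw [h3, Pi.add_apply, h4, h1, hY.mean, add_zero]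
  have hbdd : ∀ n, eLpNorm (fun ω => ∑ j ∈ Finset.range (n + 1), Y j ω) 1 P
      ≤ (Real.toNNReal √(∑' j, ∫ ω, (Y j ω) ^ 2 ∂P) : ℝ≥0∞) := fun n => by
    refine (eLpNorm_le_eLpNorm_of_exponent_le one_le_two (hY.memLp_sum _).1).trans ?_
    rw [eLpNorm_two_eq_sqrt (hY.memLp_sum _), hY.integral_sum_sq]
    refine ENNReal.ofReal_le_ofReal (Real.sqrt_le_sqrt ?_)
    exact hs.sum_le_tsum _ fun j _ => integral_nonneg fun ω => sq_nonneg _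
  refine ⟨fun ω => limUnder atTop fun m => ∑ j ∈ Finset.range m, Y j ω, ?_⟩
  filter_upwards [hmart.submartingale.exists_ae_tendsto_of_bdd hbdd] with ω hω
  obtain ⟨c, hc⟩ := hω
  exact tendsto_nhds_limUnder ⟨c, (tendsto_add_atTop_iff_nat 1).1 hc⟩

lemma IsCentredSeq.tendsto_eLpNorm (hY : IsCentredSeq Y P)
    (hs : Summable fun j => ∫ ω, (Y j ω) ^ 2 ∂P) {Z : Ω → ℝ}
    (hZ : ∀ᵐ ω ∂P, Tendsto (fun m => ∑ j ∈ Finset.range m, Y j ω) atTop (𝓝 (Z ω))) :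
    Tendsto (fun m => eLpNorm ((fun ω => ∑ j ∈ Finset.range m, Y j ω) - Z) 2 P) atTop (𝓝 0) := by
  have h1 : ∀ m, eLpNorm ((fun ω => ∑ j ∈ Finset.range m, Y j ω) - Z) 2 P
      ≤ ENNReal.ofReal √(∑' j, ∫ ω, (Y (j + m) ω) ^ 2 ∂P) := fun m => by
    have hY' : IsCentredSeq (fun j => Y (j + m)) P :=
      ⟨fun j => hY.meas _, fun j => hY.memLp _,
        hY.indep.precomp (g := fun j => j + m) (add_left_injective m), fun j => hY.mean _⟩
    rw [eLpNorm_sub_comm]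
    refine (hY'.eLpNorm_lim_le (fun k => ?_) ?_).2
    · exact ((summable_nat_add_iff m).2 hs).sum_le_tsum _
        fun j _ => integral_nonneg fun ω => sq_nonneg _
    · filter_upwards [hZ] with ω hω
      have h2 := ((tendsto_add_atTop_iff_nat m).2 hω).sub_const (∑ j ∈ Finset.range m, Y j ω)
      refine h2.congr fun k => ?_
      rw [add_comm k m, Finset.sum_range_add, add_sub_cancel_left]
      simp_rw [add_comm]
  refine tendsto_of_tendsto_of_tendsto_of_le_of_le tendsto_const_nhds ?_ (fun _ => zero_le) h1
  have h2 := tendsto_sum_nat_add fun j => ∫ ω, (Y j ω) ^ 2 ∂P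
  have h3 := ENNReal.tendsto_ofReal (h2.sqrt)
  simpa using h3

end series

/-! ### Exponential and geometric random variables -/

lemma integral_expMeasure (f : ℝ → ℝ) :
    ∫ x, f x ∂(expMeasure 1) = ∫ x in Set.Ioi (0 : ℝ), Real.exp (-x) * f x := by
  have h1 : Measurable (gammaPDF 1 1) := (measurable_gammaPDFReal 1 1).ennreal_ofReal
  rw [expMeasure, gammaMeasure, integral_withDensity_eq_integral_toReal_smul h1
    (ae_of_all _ fun x => ENNReal.ofReal_lt_top), ← integral_Ici_eq_integral_Ioi,
    ← integral_indicator measurableSet_Ici]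
  refine integral_congr_ae (ae_of_all _ fun x => ?_)
  by_cases hx : 0 ≤ x
  · beta_reduce
    rw [Set.indicator_of_mem (Set.mem_Ici.2 hx), gammaPDF_of_nonneg hx, ENNReal.toReal_ofReal]
    · simp
    · simp [(Real.exp_pos _).le]
  · beta_reduce
    rw [Set.indicator_of_notMem (by simpa using hx), gammaPDF_of_neg (not_le.1 hx)]
    simp

lemma integral_pow_expMeasure (n : ℕ) : ∫ x, x ^ n ∂(expMeasure 1) = n.factorial := by
  rw [integral_expMeasure, ← Real.Gamma_nat_eq_factorial, Real.Gamma_eq_integral (by positivity)]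
  simp

instance : IsProbabilityMeasure (expMeasure 1) := isProbabilityMeasure_expMeasure one_pos

lemma measureReal_expMeasure_Iio {x : ℝ} (hx : 0 ≤ x) :
    (expMeasure 1).real (Set.Iio x) = 1 - Real.exp (-x) := by
  have : NullSingletonClass (expMeasure 1) := by
    unfold expMeasure gammaMeasure; infer_instance
  rw [measureReal_congr (Iio_ae_eq_Iic (a := x)), ← cdf_eq_real, cdf_expMeasure_eq one_pos,
    if_pos hx, one_mul]

lemma expMeasure_ae_nonneg : ∀ᵐ x ∂(expMeasure 1), (0 : ℝ) ≤ x := by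
  have h := measureReal_expMeasure_Iio le_rfl
  rw [neg_zero, Real.exp_zero, sub_self, measureReal_eq_zero_iff] at h
  rw [ae_iff]
  convert h using 2
  ext x; simp

/-- The success probability `1 - exp (-b)` of the geometric law obtained by rounding down an
exponential variable to a multiple of `b`. -/
noncomputable def geomParam (b : ℝ) (hb : 0 < b) : unitInterval :=
  ⟨1 - Real.exp (-b), by linarith [Real.exp_lt_one_iff.2 (neg_lt_zero.2 hb)],
    by linarith [Real.exp_pos (-b)]⟩

lemma geomParam_ne_zero {b : ℝ} (hb : 0 < b) : geomParam b hb ≠ 0 := by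
  intro h
  have : (geomParam b hb : ℝ) = 0 := by rw [h]; rfl
  have h2 : (1 : ℝ) - Real.exp (-b) = 0 := this
  linarith [Real.exp_lt_one_iff.2 (neg_lt_zero.2 hb)]

lemma measurable_floor_div (b : ℝ) : Measurable fun x : ℝ => ⌊x / b⌋₊ :=
  Nat.measurable_floor.comp (measurable_id.div_const b)

/-- The integer part of an exponential variable divided by `b` is geometric. -/
lemma map_floor_expMeasure {b : ℝ} (hb : 0 < b) :
    (expMeasure 1).map (fun x => ⌊x / b⌋₊) = geometricMeasure (geomParam b hb) := by
  have hm := measurable_floor_div b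
  have : IsProbabilityMeasure ((expMeasure 1).map (fun x => ⌊x / b⌋₊)) :=
    Measure.isProbabilityMeasure_map hm.aemeasurable
  refine Measure.ext_of_singleton fun k => ?_
  rw [← ENNReal.toReal_eq_toReal_iff' (measure_ne_top _ _) (measure_ne_top _ _)]
  change Measure.real _ _ = Measure.real _ _
  rw [geometricMeasure_real_singleton (geomParam_ne_zero hb),
    map_measureReal_apply hm (measurableSet_singleton k)]
  have h1 : (fun x : ℝ => ⌊x / b⌋₊) ⁻¹' {k}
      = Set.Iio (((k : ℝ) + 1) * b) \ (if k = 0 then ∅ else Set.Iio ((k : ℝ) * b)) := by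
    ext x
    rcases Nat.eq_zero_or_pos k with rfl | hk
    · simp [Nat.floor_eq_zero, div_lt_iff₀ hb]
    · simp only [Set.mem_preimage, Set.mem_singleton_iff, Nat.floor_eq_iff' hk.ne', if_neg hk.ne',
        Set.mem_sdiff, Set.mem_Iio, not_lt, le_div_iff₀ hb, div_lt_iff₀ hb]
      tauto
  have h2 : (geomParam b hb : ℝ) = 1 - Real.exp (-b) := rfl
  have h3 : (expMeasure 1).real (if k = 0 then ∅ else Set.Iio ((k : ℝ) * b))
      = 1 - Real.exp (-(k * b)) := by
    split_ifs with hk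
    · simp [hk]
    · rw [measureReal_expMeasure_Iio (by positivity)]
  rw [h1, measureReal_sdiff, h3, measureReal_expMeasure_Iio (by positivity), h2, sub_sub_cancel,
    ← Real.exp_nat_mul]
  · rw [show -(((k : ℝ) + 1) * b) = k * -b + -b by ring, Real.exp_add]
    ring_nf
  · split_ifs
    · exact Set.empty_subset _
    · exact Set.Iio_subset_Iio (by nlinarith)
  · split_ifs
    · exact MeasurableSet.empty
    · exact measurableSet_Iio

lemma exp_neg_lt_one {b : ℝ} (hb : 0 < b) : Real.exp (-b) < 1 :=
  Real.exp_lt_one_iff.2 (neg_lt_zero.2 hb)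

lemma coe_geomParam {b : ℝ} (hb : 0 < b) : (geomParam b hb : ℝ) = 1 - Real.exp (-b) := rfl

lemma integrable_geom {F : Type*} [NormedAddCommGroup F] {b : ℝ} (hb : 0 < b) {f : ℕ → F}
    (hf : Summable fun n => Real.exp (-b) ^ n * (1 - Real.exp (-b)) * ‖f n‖) :
    Integrable f (geometricMeasure (geomParam b hb)) := by
  rw [integrable_geometricMeasure_iff (geomParam_ne_zero hb)]
  simpa [coe_geomParam] using hf

lemma hasSum_integral_geom {F : Type*} [NormedAddCommGroup F] [NormedSpace ℝ F] [CompleteSpace F]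
    {b : ℝ} (hb : 0 < b) {f : ℕ → F} (hf : Integrable f (geometricMeasure (geomParam b hb))) :
    HasSum (fun n => (Real.exp (-b) ^ n * (1 - Real.exp (-b))) • f n)
      (∫ n, f n ∂(geometricMeasure (geomParam b hb))) := by
  simpa [coe_geomParam] using hasSum_integral_geometricMeasure (geomParam_ne_zero hb) hf

lemma integrable_pow_geom {b : ℝ} (hb : 0 < b) (r : ℕ) :
    Integrable (fun n : ℕ => (n : ℝ) ^ r) (geometricMeasure (geomParam b hb)) := by
  refine integrable_geom hb ?_
  have hp : ‖Real.exp (-b)‖ < 1 := by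
    rw [Real.norm_of_nonneg (Real.exp_pos _).le]; exact exp_neg_lt_one hb
  refine ((summable_pow_mul_geometric_of_norm_lt_one r hp).mul_right
    (1 - Real.exp (-b))).congr fun n => ?_
  rw [Real.norm_of_nonneg (by positivity)]
  ring

lemma integral_geom {b : ℝ} (hb : 0 < b) :
    HasSum (fun k : ℕ => Real.exp (-b) ^ (k + 1))
      (∫ n, (n : ℝ) ∂(geometricMeasure (geomParam b hb))) := by
  have hp := exp_neg_lt_one hb
  have hp' : ‖Real.exp (-b)‖ < 1 := by
    rwa [Real.norm_of_nonneg (Real.exp_pos _).le]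
  have h1 := hasSum_integral_geom hb (integrable_pow_geom hb 1)
  simp only [pow_one] at h1
  have h2 := (hasSum_coe_mul_geometric_of_norm_lt_one hp').mul_right (1 - Real.exp (-b))
  have h3 := h1.unique (h2.congr_fun fun n => by simp only [smul_eq_mul]; ring)
  rw [h3]
  have h4 := (hasSum_geometric_of_lt_one (Real.exp_pos (-b)).le hp).mul_left (Real.exp (-b))
  have h5 : Real.exp (-b) / (1 - Real.exp (-b)) ^ 2 * (1 - Real.exp (-b))
      = Real.exp (-b) * (1 - Real.exp (-b))⁻¹ := by
    have : 1 - Real.exp (-b) ≠ 0 := by linarith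
    field_simp
  rw [h5]
  exact h4.congr_fun fun k => by rw [pow_succ']

lemma integral_sq_geom_le {b : ℝ} (hb : 0 < b) :
    ∫ n, (n : ℝ) ^ 2 ∂(geometricMeasure (geomParam b hb))
      ≤ 2 * ∑' k : ℕ, ((k : ℝ) + 1) * Real.exp (-b) ^ (k + 1) := by
  have hp := exp_neg_lt_one hb
  have hp' : ‖Real.exp (-b)‖ < 1 := by
    rwa [Real.norm_of_nonneg (Real.exp_pos _).le]
  set p := Real.exp (-b) with hpdef
  have hp0 : 0 < p := Real.exp_pos _
  have h1 := hasSum_integral_geom hb (integrable_pow_geom hb 2)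
  have h2 := (hasSum_choose_mul_geometric_of_norm_lt_one 2 hp').mul_right (2 * p * (1 - p))
  have h3 : HasSum (fun n : ℕ => (p ^ n * (1 - p)) • ((n : ℝ) * (n + 1)))
      (1 / (1 - p) ^ (2 + 1) * (2 * p * (1 - p))) := by
    rw [← hasSum_nat_add_iff' 1]
    simp only [Finset.range_one, Finset.sum_singleton, Nat.cast_zero, zero_mul, smul_zero, sub_zero]
    refine h2.congr_fun fun n => ?_
    rw [smul_eq_mul, Nat.cast_choose_two]
    push_cast
    ring
  have h4 : ∫ n, (n : ℝ) ^ 2 ∂(geometricMeasure (geomParam b hb))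
      ≤ 1 / (1 - p) ^ (2 + 1) * (2 * p * (1 - p)) := by
    refine hasSum_le (fun n => ?_) h1 h3
    rw [smul_eq_mul, smul_eq_mul]
    have : 0 < 1 - p := by linarith
    gcongr
    nlinarith [(Nat.cast_nonneg n : (0 : ℝ) ≤ n)]
  have h5 := hasSum_coe_mul_geometric_of_norm_lt_one hp'
  rw [← hasSum_nat_add_iff' 1] at h5
  simp only [Finset.range_one, Finset.sum_singleton, Nat.cast_zero, zero_mul, sub_zero,
    Nat.cast_add, Nat.cast_one] at h5
  rw [h5.tsum_eq]
  refine h4.trans (le_of_eq ?_)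
  have : 1 - p ≠ 0 := by linarith
  field_simp

/-- The coefficients of the Lévy-Khintchine exponent of a centred geometric variable. -/
noncomputable def levyTerm (θ : ℝ) (k : ℕ) : ℂ :=
  (Complex.exp (((k : ℝ) + 1) * θ * Complex.I) - 1 - ((k : ℝ) + 1) * θ * Complex.I)
    / ((k : ℝ) + 1)

/-- A geometric law is compound Poisson: the characteristic function of the centred variable is the
exponential of `∑ₖ p ^ k (exp (i k θ) - 1 - i k θ) / k`. -/
lemma charFun_centred_geom {b : ℝ} (hb : 0 < b) (θ : ℝ) :
    ∃ ψ : ℂ, HasSum (fun k : ℕ => (Real.exp (-b) ^ (k + 1) : ℝ) * levyTerm θ k) ψ ∧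
      ∫ n : ℕ, Complex.exp (θ * (((n : ℝ) - ∫ l, (l : ℝ) ∂(geometricMeasure (geomParam b hb)) : ℝ))
        * Complex.I) ∂(geometricMeasure (geomParam b hb)) = Complex.exp ψ := by
  have hm := integral_geom hb
  set m := ∫ l, (l : ℝ) ∂(geometricMeasure (geomParam b hb)) with hmdef
  have hp := exp_neg_lt_one hb
  set p := Real.exp (-b) with hpdef
  have hp0 : 0 < p := Real.exp_pos _
  set z : ℂ := p * Complex.exp (θ * Complex.I) with hz
  have hznorm : ‖z‖ < 1 := by
    rw [hz, norm_mul, Complex.norm_exp_ofReal_mul_I, mul_one, Complex.norm_real,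
      Real.norm_of_nonneg hp0.le]
    exact hp
  have hpnorm : ‖(p : ℂ)‖ < 1 := by
    rw [Complex.norm_real, Real.norm_of_nonneg hp0.le]
    exact hp
  have hlog : ∀ w : ℂ, ‖w‖ < 1 →
      HasSum (fun k : ℕ => w ^ (k + 1) / ((k : ℝ) + 1)) (-Complex.log (1 - w)) := fun w hw => by
    have := Complex.hasSum_taylorSeries_neg_log hw
    rw [← hasSum_nat_add_iff' 1] at this
    simpa using this
  have h1z : 1 - z ≠ 0 := fun h => by
    rw [← sub_eq_zero.1 h] at hznorm
    simp at hznorm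
  have h1p : (1 : ℂ) - p ≠ 0 := fun h => by
    rw [← sub_eq_zero.1 h] at hpnorm
    simp at hpnorm
  have hmc := (Complex.hasSum_ofReal.2 hm).mul_right (θ * Complex.I)
  have hsum := ((hlog z hznorm).sub (hlog p hpnorm)).sub hmc
  refine ⟨_, hsum.congr_fun fun k => ?_, ?_⟩
  · rw [levyTerm, hz, mul_pow, ← Complex.exp_nat_mul]
    have : ((k : ℝ) : ℂ) + 1 ≠ 0 := by
      exact_mod_cast (Nat.cast_add_one_ne_zero k : (k : ℂ) + 1 ≠ 0)
    push_cast
    field_simp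
  · have h2 : ∀ n : ℕ, Complex.exp (θ * (((n : ℝ) - m : ℝ)) * Complex.I)
        = Complex.exp (-(m * (θ * Complex.I))) * Complex.exp (θ * Complex.I) ^ n := fun n => by
      rw [← Complex.exp_nat_mul, ← Complex.exp_add]
      push_cast
      ring_nf
    simp_rw [h2]
    rw [integral_const_mul]
    have h3 := hasSum_integral_geom hb (f := fun n => Complex.exp (θ * Complex.I) ^ n)
      (integrable_geom hb (by
        simp only [norm_pow, Complex.norm_exp_ofReal_mul_I, one_pow, mul_one]
        exact (summable_geometric_of_lt_one hp0.le hp).mul_right _))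
    rw [← hpdef] at h3
    have h4 := (hasSum_geometric_of_norm_lt_one hznorm).mul_right (1 - (p : ℂ))
    rw [h3.unique (h4.congr_fun fun n => by
      rw [hz, mul_pow, Complex.real_smul]; push_cast; ring)]
    rw [Complex.exp_sub, Complex.exp_sub, Complex.exp_neg, Complex.exp_neg, Complex.exp_neg,
      Complex.exp_log h1z, Complex.exp_log h1p]
    have := Complex.exp_ne_zero (m * (θ * Complex.I))
    field_simp

/-! ### Independent geometric occupation numbers -/

namespace IsSpectrum

variable {D : ℕ → ℝ} {L α : ℝ}

/-- Interchange of the sum over the levels `j` and the sum over the multiples `k` of `β`. -/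
lemma hasSum_levels {F : Type*} [NormedAddCommGroup F] [NormedSpace ℝ F] [CompleteSpace F]
    (h : IsSpectrum D L α) {β : ℝ} (hβ : 0 < β) {c : ℕ → F} {B : ℝ}
    (hc : ∀ k : ℕ, ‖c k‖ ≤ B * ((k : ℝ) + 1)) {a : ℕ → F}
    (ha : ∀ j, HasSum (fun k : ℕ => (Real.exp (-(β * D j)) ^ (k + 1)) • c k) (a j)) :
    HasSum a (∑' k : ℕ, heatTrace D (((k : ℝ) + 1) * β) • c k) := by
  have hexp : ∀ (k j : ℕ), Real.exp (-(β * D j)) ^ (k + 1)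
      = Real.exp (-(((k : ℝ) + 1) * β) * D j) :=
    fun (k : ℕ) j => by
      rw [← Real.exp_nat_mul]
      push_cast
      ring_nf
  have hK : ∀ k : ℕ, HasSum (fun j => Real.exp (-(β * D j)) ^ (k + 1))
      (heatTrace D (((k : ℝ) + 1) * β)) := fun k => by
    simp_rw [hexp]
    exact (h.summable_exp (by positivity)).hasSum
  have hs : Summable fun x : ℕ × ℕ => (Real.exp (-(β * D x.2)) ^ (x.1 + 1)) • c x.1 := by
    refine Summable.of_norm ?_
    rw [summable_prod_of_nonneg fun x => norm_nonneg _]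
    have hn : ∀ k j, ‖(Real.exp (-(β * D j)) ^ (k + 1)) • c k‖
        = Real.exp (-(β * D j)) ^ (k + 1) * ‖c k‖ := fun k j => by
      rw [norm_smul, Real.norm_of_nonneg (by positivity)]
    simp_rw [hn]
    refine ⟨fun k => (hK k).summable.mul_right _, ?_⟩
    simp_rw [fun k => ((hK k).mul_right ‖c k‖).tsum_eq]
    refine Summable.of_nonneg_of_le (fun k => mul_nonneg (heatTrace_nonneg _ _) (norm_nonneg _))
      (fun k => ?_) ((h.summable_pow_mul_heatTrace 1 hβ).mul_left B)
    calc _ ≤ heatTrace D (((k : ℝ) + 1) * β) * (B * ((k : ℝ) + 1)) :=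
          mul_le_mul_of_nonneg_left (hc k) (heatTrace_nonneg _ _)
      _ = _ := by ring
  have h1 : HasSum (fun k : ℕ => heatTrace D (((k : ℝ) + 1) * β) • c k)
      (∑' x : ℕ × ℕ, (Real.exp (-(β * D x.2)) ^ (x.1 + 1)) • c x.1) :=
    hs.hasSum.prod_fiberwise fun k => (hK k).smul_const (c k)
  rw [h1.tsum_eq]
  have h2 := (Equiv.prodComm ℕ ℕ).hasSum_iff.2 hs.hasSum
  exact h2.prod_fiberwise ha

end IsSpectrum

/-- A sequence of independent exponential random variables with mean `1`. -/
structure IsExpSeq {Ω : Type*} [MeasurableSpace Ω] (X : ℕ → Ω → ℝ) (P : Measure Ω) : Prop where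
  meas : ∀ j, Measurable (X j)
  indep : iIndepFun X P
  law : ∀ j, HasLaw (X j) (expMeasure 1) P

/-- The occupation number of the excited level `j`, obtained from the exponential variable `X j`
by rounding `X j / (β D j)` down. It is geometric with parameter `exp (-β D j)`. -/
noncomputable def occ {Ω : Type*} (D : ℕ → ℝ) (β : ℝ) (X : ℕ → Ω → ℝ) (j : ℕ) (ω : Ω) : ℕ :=
  ⌊X j ω / (β * D j)⌋₊

/-- The total number of excited particles when the occupation numbers are independent. -/
noncomputable def total {Ω : Type*} (D : ℕ → ℝ) (β : ℝ) (X : ℕ → Ω → ℝ) (ω : Ω) : ℝ :=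
  ∑' j, (occ D β X j ω : ℝ)

/-- The mean number of excited particles. -/
noncomputable def meanTotal (D : ℕ → ℝ) (β : ℝ) : ℝ := ∑' k : ℕ, heatTrace D (((k : ℝ) + 1) * β)

section occupation

variable {Ω : Type*} [MeasurableSpace Ω] {P : Measure Ω}
  {X : ℕ → Ω → ℝ} {D : ℕ → ℝ} {L α β : ℝ}

lemma IsExpSeq.integral_pow (hX : IsExpSeq X P) (j n : ℕ) :
    ∫ ω, (X j ω) ^ n ∂P = n.factorial := by
  rw [← integral_pow_expMeasure n]
  exact (hX.law j).integral_comp (f := fun x => x ^ n) (by fun_prop)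

lemma IsExpSeq.integrable_pow (hX : IsExpSeq X P) (j n : ℕ) :
    Integrable (fun ω => (X j ω) ^ n) P := by
  by_contra hn
  have h1 := hX.integral_pow j n
  rw [integral_undef hn] at h1
  exact n.factorial_ne_zero (by exact_mod_cast h1.symm)

lemma IsExpSeq.ae_nonneg (hX : IsExpSeq X P) (j : ℕ) : ∀ᵐ ω ∂P, 0 ≤ X j ω :=
  ((hX.law j).ae_iff (measurableSet_Ici (a := (0 : ℝ))).mem).2 expMeasure_ae_nonneg

lemma IsExpSeq.measurable_occ (hX : IsExpSeq X P) (j : ℕ) : Measurable (occ D β X j) :=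
  (measurable_floor_div (β * D j)).comp (hX.meas j)

lemma IsExpSeq.measurable_occ_cast (hX : IsExpSeq X P) (j : ℕ) :
    Measurable fun ω => (occ D β X j ω : ℝ) :=
  (measurable_from_top (f := fun n : ℕ => (n : ℝ))).comp (hX.measurable_occ j)

lemma IsExpSeq.iIndepFun_occ (hX : IsExpSeq X P) : iIndepFun (fun j => occ D β X j) P :=
  hX.indep.comp (fun j x => ⌊x / (β * D j)⌋₊) fun j => measurable_floor_div (β * D j)

lemma IsExpSeq.memLp (hX : IsExpSeq X P) (j : ℕ) : MemLp (X j) 2 P :=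
  (memLp_two_iff_integrable_sq (hX.meas j).aestronglyMeasurable).2 (hX.integrable_pow j 2)

lemma IsExpSeq.hasLaw_occ (hX : IsExpSeq X P) (hβ : 0 < β) (h : IsSpectrum D L α) (j : ℕ) :
    HasLaw (occ D β X j) (geometricMeasure (geomParam (β * D j) (mul_pos hβ (h.pos j)))) P where
  aemeasurable := (hX.measurable_occ j).aemeasurable
  map_eq := by
    rw [← map_floor_expMeasure, ← (hX.law j).map_eq, Measure.map_map (measurable_floor_div _)
      (hX.meas j)]
    rfl

lemma IsExpSeq.measurable_total (hX : IsExpSeq X P) : Measurable (total D β X) :=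
  Measurable.tsum fun j => hX.measurable_occ_cast j

lemma IsExpSeq.integral_eq_one (hX : IsExpSeq X P) (j : ℕ) : ∫ ω, X j ω ∂P = 1 := by
  simpa using hX.integral_pow j 1

lemma IsExpSeq.integrable_occ_pow (hX : IsExpSeq X P) (hβ : 0 < β) (h : IsSpectrum D L α)
    (j r : ℕ) : Integrable (fun ω => (occ D β X j ω : ℝ) ^ r) P :=
  ((hX.hasLaw_occ hβ h j).map_eq ▸ integrable_pow_geom (mul_pos hβ (h.pos j)) r :
    Integrable (fun n : ℕ => (n : ℝ) ^ r) (P.map (occ D β X j))).comp_measurable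
      (hX.measurable_occ j)

lemma IsExpSeq.integrable_occ (hX : IsExpSeq X P) (hβ : 0 < β) (h : IsSpectrum D L α)
    (j : ℕ) : Integrable (fun ω => (occ D β X j ω : ℝ)) P := by
  simpa using hX.integrable_occ_pow hβ h j 1

lemma IsExpSeq.integral_occ_comp (hX : IsExpSeq X P) (hβ : 0 < β) (h : IsSpectrum D L α)
    (j : ℕ) {F : Type*} [NormedAddCommGroup F] [NormedSpace ℝ F] (f : ℕ → F) :
    ∫ ω, f (occ D β X j ω) ∂P
      = ∫ n, f n ∂(geometricMeasure (geomParam (β * D j) (mul_pos hβ (h.pos j)))) :=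
  (hX.hasLaw_occ hβ h j).integral_comp (f := f)
    (StronglyMeasurable.of_discrete).aestronglyMeasurable

lemma IsExpSeq.hasSum_integral_occ (hX : IsExpSeq X P) (hβ : 0 < β) (h : IsSpectrum D L α) :
    HasSum (fun j => ∫ ω, (occ D β X j ω : ℝ) ∂P) (meanTotal D β) := by
  have h1 := h.hasSum_levels hβ (c := fun _ => (1 : ℝ)) (B := 1)
    (a := fun j => ∫ ω, (occ D β X j ω : ℝ) ∂P) (fun k => by simp) fun j => by
      rw [hX.integral_occ_comp hβ h j fun n => (n : ℝ)]
      simpa using integral_geom (mul_pos hβ (h.pos j))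
  simpa [meanTotal] using h1

lemma IsExpSeq.ae_summable_occ (hX : IsExpSeq X P) (hβ : 0 < β) (h : IsSpectrum D L α) :
    ∀ᵐ ω ∂P, Summable fun j => (occ D β X j ω : ℝ) := by
  have h1 := summable_norm_of_tsum_eLpNorm_ne_top (μ := P) le_rfl
    (f := fun j ω => (occ D β X j ω : ℝ)) (fun j => (hX.measurable_occ_cast j).aestronglyMeasurable)
  simp only [Real.norm_natCast] at h1
  refine h1 ?_
  have h2 : ∀ j, eLpNorm (fun ω => (occ D β X j ω : ℝ)) 1 P
      = ENNReal.ofReal (∫ ω, (occ D β X j ω : ℝ) ∂P) := fun j => by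
    rw [eLpNorm_one_eq_lintegral_enorm, ← ofReal_integral_norm_eq_lintegral_enorm
      (hX.integrable_occ hβ h j)]
    simp
  simp_rw [h2]
  rw [← ENNReal.ofReal_tsum_of_nonneg (fun j => integral_nonneg fun ω => Nat.cast_nonneg _)
    (hX.hasSum_integral_occ hβ h).summable]
  exact ENNReal.ofReal_ne_top

lemma IsExpSeq.integral_total (hX : IsExpSeq X P) (hβ : 0 < β) (h : IsSpectrum D L α) :
    ∫ ω, total D β X ω ∂P = meanTotal D β := by
  refine (hasSum_integral_of_summable_integral_norm (fun j => hX.integrable_occ hβ h j) ?_).unique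
    (hX.hasSum_integral_occ hβ h)
  simpa using (hX.hasSum_integral_occ hβ h).summable

/-- The centred occupation number. -/
noncomputable def centredOcc (D : ℕ → ℝ) (β : ℝ) (X : ℕ → Ω → ℝ) (P : Measure Ω) (j : ℕ) (ω : Ω) :
    ℝ :=
  occ D β X j ω - ∫ ω', (occ D β X j ω' : ℝ) ∂P

lemma IsExpSeq.ae_tendsto_centredOcc (hX : IsExpSeq X P) (hβ : 0 < β) (h : IsSpectrum D L α) :
    ∀ᵐ ω ∂P, Tendsto (fun m => ∑ j ∈ Finset.range m, centredOcc D β X P j ω) atTop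
      (𝓝 (total D β X ω - meanTotal D β)) := by
  filter_upwards [hX.ae_summable_occ hβ h] with ω hω
  exact (hω.hasSum.sub (hX.hasSum_integral_occ hβ h)).tendsto_sum_nat

variable [IsProbabilityMeasure P]

lemma IsExpSeq.isCentredSeq_occ (hX : IsExpSeq X P) (hβ : 0 < β) (h : IsSpectrum D L α) :
    IsCentredSeq (centredOcc D β X P) P where
  meas j := (hX.measurable_occ_cast j).sub_const _
  memLp j := ((memLp_two_iff_integrable_sq (hX.measurable_occ_cast j).aestronglyMeasurable).2
    (hX.integrable_occ_pow hβ h j 2)).sub (memLp_const _)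
  indep := hX.iIndepFun_occ.comp (fun j n => (n : ℝ) - ∫ ω', (occ D β X j ω' : ℝ) ∂P)
    fun j => measurable_from_top
  mean j := by
    unfold centredOcc
    rw [integral_sub (hX.integrable_occ hβ h j) (integrable_const _)]
    simp

lemma IsExpSeq.integral_centredOcc_sq_le (hX : IsExpSeq X P)
    (j : ℕ) : ∫ ω, (centredOcc D β X P j ω) ^ 2 ∂P ≤ ∫ ω, (occ D β X j ω : ℝ) ^ 2 ∂P := by
  have h1 := variance_le_expectation_sq (μ := P)
    (hX.measurable_occ_cast (D := D) (β := β) j).aestronglyMeasurable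
  rw [variance_eq_integral (hX.measurable_occ_cast j).aemeasurable] at h1
  exact h1

lemma IsExpSeq.memLp_total (hX : IsExpSeq X P) (hβ : 0 < β) (h : IsSpectrum D L α) :
    MemLp (fun ω => total D β X ω - meanTotal D β) 2 P ∧
    ∫ ω, (total D β X ω - meanTotal D β) ^ 2 ∂P
      ≤ 2 * ∑' k : ℕ, ((k : ℝ) + 1) * heatTrace D (((k : ℝ) + 1) * β) := by
  have h1 : HasSum (fun j => ∑' k : ℕ, ((k : ℝ) + 1) * Real.exp (-(β * D j)) ^ (k + 1))
      (∑' k : ℕ, heatTrace D (((k : ℝ) + 1) * β) • ((k : ℝ) + 1)) := by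
    refine h.hasSum_levels hβ (B := 1) (fun k => ?_) fun j => ?_
    · rw [one_mul, Real.norm_of_nonneg (by positivity)]
    · have hp := exp_neg_lt_one (mul_pos hβ (h.pos j))
      have h2 := (summable_nat_add_iff (f := fun k : ℕ => (k : ℝ) ^ 1 *
        Real.exp (-(β * D j)) ^ k) 1).2 (summable_pow_mul_geometric_of_norm_lt_one 1
          (by rwa [Real.norm_of_nonneg (Real.exp_pos _).le]))
      refine (h2.congr fun k => ?_).hasSum.congr_fun fun k => ?_
      · push_cast; rw [pow_one]
      · rw [smul_eq_mul, mul_comm]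
  have hB : ∀ m, ∑ j ∈ Finset.range m, ∫ ω, (centredOcc D β X P j ω) ^ 2 ∂P
      ≤ 2 * ∑' k : ℕ, ((k : ℝ) + 1) * heatTrace D (((k : ℝ) + 1) * β) := fun m => by
    have h3 : ∑' k : ℕ, heatTrace D (((k : ℝ) + 1) * β) • ((k : ℝ) + 1)
        = ∑' k : ℕ, ((k : ℝ) + 1) * heatTrace D (((k : ℝ) + 1) * β) :=
      tsum_congr fun k => by rw [smul_eq_mul, mul_comm]
    rw [h3] at h1
    refine le_trans (Finset.sum_le_sum fun j _ => ?_)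
      ((h1.mul_left 2).summable.sum_le_tsum (Finset.range m) (fun j _ => ?_) |>.trans
        (h1.mul_left 2).tsum_eq.le)
    · refine (hX.integral_centredOcc_sq_le j).trans ?_
      rw [hX.integral_occ_comp hβ h j fun n => (n : ℝ) ^ 2]
      exact integral_sq_geom_le _
    · exact mul_nonneg zero_le_two (tsum_nonneg fun k => by positivity)
  exact ⟨((hX.isCentredSeq_occ hβ h).eLpNorm_lim_le hB (hX.ae_tendsto_centredOcc hβ h)).1,
    (hX.isCentredSeq_occ hβ h).integral_lim_sq_le hB (hX.ae_tendsto_centredOcc hβ h)⟩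

lemma norm_levyTerm_le (θ : ℝ) (k : ℕ) : ‖levyTerm θ k‖ ≤ (2 + |θ|) * ((k : ℝ) + 1) := by
  have hk : (1 : ℝ) ≤ (k : ℝ) + 1 := by linarith [(Nat.cast_nonneg k : (0 : ℝ) ≤ k)]
  have h1 : ‖((k : ℝ) : ℂ) + 1‖ = (k : ℝ) + 1 := by
    rw [← Complex.ofReal_one, ← Complex.ofReal_add, Complex.norm_real,
      Real.norm_of_nonneg (by positivity)]
  rw [levyTerm, norm_div, h1, div_le_iff₀ (by positivity)]
  have h2 : ‖Complex.exp (((k : ℝ) + 1) * θ * Complex.I)‖ = 1 := by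
    have := Complex.norm_exp_ofReal_mul_I (((k : ℝ) + 1) * θ)
    push_cast at this ⊢
    exact this
  have h3 : ‖(((k : ℝ) : ℂ) + 1) * θ * Complex.I‖ = ((k : ℝ) + 1) * |θ| := by
    rw [norm_mul, norm_mul, h1, Complex.norm_I, mul_one, Complex.norm_real, Real.norm_eq_abs]
  calc _ ≤ 1 + 1 + ((k : ℝ) + 1) * |θ| := by
        refine (norm_sub_le _ _).trans ?_
        rw [h3]
        gcongr
        refine (norm_sub_le _ _).trans ?_
        rw [h2, norm_one]
    _ ≤ (2 + |θ|) * ((k : ℝ) + 1) * ((k : ℝ) + 1) := by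
      have := abs_nonneg θ
      nlinarith [mul_nonneg this (by linarith : 0 ≤ (k : ℝ))]

/-- The number of excited particles is compound Poisson: a cluster of `k + 1` particles appears at
rate `K((k + 1) β) / (k + 1)`. -/
lemma IsExpSeq.charFun_total (hX : IsExpSeq X P) (hβ : 0 < β) (h : IsSpectrum D L α) (θ : ℝ) :
    ∫ ω, Complex.exp (θ * ((total D β X ω - meanTotal D β : ℝ)) * Complex.I) ∂P
      = Complex.exp (∑' k : ℕ, heatTrace D (((k : ℝ) + 1) * β) • levyTerm θ k) := by
  have hpos := fun j => mul_pos hβ (h.pos j)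
  choose ψ hψ hψ' using fun j => charFun_centred_geom (hpos j) θ
  have h1 : HasSum ψ (∑' k : ℕ, heatTrace D (((k : ℝ) + 1) * β) • levyTerm θ k) :=
    h.hasSum_levels hβ (norm_levyTerm_le θ) fun j => (hψ j).congr_fun fun k => by
      rw [Complex.real_smul]
  have hc := hX.isCentredSeq_occ hβ h
  have h2 : ∀ m, ∫ ω, Complex.exp (θ * ((∑ j ∈ Finset.range m, centredOcc D β X P j ω : ℝ)) *
      Complex.I) ∂P = Complex.exp (∑ j ∈ Finset.range m, ψ j) := fun m => by
    have h3 := congrFun (iIndepFun.charFun_map_fun_finsetSum_eq_prod (s := Finset.range m)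
      (fun j _ => (hc.meas j).aemeasurable) (hc.indep.restrict _)) θ
    rw [charFun_apply_real, integral_map (Finset.aemeasurable_fun_sum _
      fun j _ => (hc.meas j).aemeasurable) (by fun_prop)] at h3
    rw [h3, Finset.prod_apply, Complex.exp_sum]
    refine Finset.prod_congr rfl fun j _ => ?_
    rw [charFun_apply_real, integral_map (hc.meas j).aemeasurable (by fun_prop), ← hψ' j,
      ← hX.integral_occ_comp hβ h j, ← hX.integral_occ_comp hβ h j]
    rfl
  have h3 : Tendsto (fun m => ∫ ω, Complex.exp (θ * ((∑ j ∈ Finset.range m,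
      centredOcc D β X P j ω : ℝ)) * Complex.I) ∂P) atTop
      (𝓝 (∫ ω, Complex.exp (θ * ((total D β X ω - meanTotal D β : ℝ)) * Complex.I) ∂P)) := by
    refine tendsto_integral_of_dominated_convergence (fun _ => 1) (fun m => ?_)
      (integrable_const _) (fun m => ae_of_all _ fun ω => ?_) ?_
    · have : Measurable fun ω => ∑ j ∈ Finset.range m, centredOcc D β X P j ω :=
        Finset.measurable_fun_sum _ fun j _ => hc.meas j
      exact (by fun_prop : Measurable fun ω => Complex.exp (θ * ((∑ j ∈ Finset.range m,
        centredOcc D β X P j ω : ℝ)) * Complex.I)).aestronglyMeasurable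
    · rw [← Complex.ofReal_mul, Complex.norm_exp_ofReal_mul_I]
    · filter_upwards [hX.ae_tendsto_centredOcc hβ h] with ω hω
      have : Continuous fun x : ℝ => Complex.exp (θ * (x : ℂ) * Complex.I) := by fun_prop
      exact (this.tendsto _).comp hω
  refine tendsto_nhds_unique h3 ?_
  simp_rw [h2]
  exact (Complex.continuous_exp.tendsto _).comp h1.tendsto_sum_nat

end occupation

/-! ### Convergence of the excitation number in `L²` when `α < 2` -/

section coupling

variable {Ω : Type*} [MeasurableSpace Ω] {P : Measure Ω} [IsProbabilityMeasure P]
  {X : ℕ → Ω → ℝ} {D : ℕ → ℝ} {L α β : ℝ}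

lemma IsExpSeq.isCentredSeq_div (hX : IsExpSeq X P) (D : ℕ → ℝ) :
    IsCentredSeq (fun j ω => (X j ω - 1) / D j) P where
  meas j := ((hX.meas j).sub_const _).div_const _
  memLp j := by
    simp_rw [div_eq_inv_mul]
    exact ((hX.memLp j).sub (memLp_const 1)).const_mul _
  indep := hX.indep.comp (fun j x => (x - 1) / D j) fun j => by fun_prop
  mean j := by
    rw [integral_div, integral_sub ((hX.memLp j).integrable one_le_two) (integrable_const _),
      hX.integral_eq_one]
    simp

lemma IsExpSeq.integral_div_sq (hX : IsExpSeq X P) (D : ℕ → ℝ) (j : ℕ) :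
    ∫ ω, ((X j ω - 1) / D j) ^ 2 ∂P = 1 / D j ^ 2 := by
  have h1 : ∫ ω, (X j ω - 1) ^ 2 ∂P = 1 := by
    have h2 := variance_eq_sub (hX.memLp j)
    rw [variance_eq_integral (hX.meas j).aemeasurable] at h2
    simp only [hX.integral_eq_one, Pi.pow_apply, hX.integral_pow j 2] at h2
    rw [h2]
    norm_num [Nat.factorial]
  simp_rw [div_pow]
  rw [integral_div, h1]

/-- The rounding error `β N - X / D` is at most `min β (X / D)`. -/
lemma sub_floor_sq_le {x d β : ℝ} (hx : 0 ≤ x) (hd : 0 < d) (hβ : 0 < β) :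
    (β * ⌊x / (β * d)⌋₊ - x / d) ^ 2 ≤ β ^ 2 ∧ (β * ⌊x / (β * d)⌋₊ - x / d) ^ 2 ≤ (x / d) ^ 2 ∧
    (β * (⌊x / (β * d)⌋₊ : ℝ)) ^ 2 ≤ (x / d) ^ 2 := by
  have h1 : (⌊x / (β * d)⌋₊ : ℝ) ≤ x / (β * d) := Nat.floor_le (by positivity)
  have h2 : x / (β * d) < ⌊x / (β * d)⌋₊ + 1 := Nat.lt_floor_add_one _
  have h3 : β * (x / (β * d)) = x / d := by field_simp
  have h4 : β * ⌊x / (β * d)⌋₊ ≤ x / d := by rw [← h3]; gcongr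
  have h5 : x / d ≤ β * ⌊x / (β * d)⌋₊ + β := by
    rw [← h3]
    nlinarith
  have h6 : 0 ≤ β * (⌊x / (β * d)⌋₊ : ℝ) := by positivity
  have h7 : 0 ≤ x / d := by positivity
  refine ⟨sq_le_sq' ?_ ?_, sq_le_sq' ?_ ?_, sq_le_sq' ?_ ?_⟩ <;> linarith

lemma IsExpSeq.integral_rounding_sq_le (hX : IsExpSeq X P) (hβ : 0 < β) (h : IsSpectrum D L α)
    (j : ℕ) :
    ∫ ω, (β * centredOcc D β X P j ω - (X j ω - 1) / D j) ^ 2 ∂P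
      ≤ min (β ^ 2) (2 / D j ^ 2) := by
  have hD := h.pos j
  have hXi := (hX.memLp j).integrable one_le_two
  set R : Ω → ℝ := fun ω => β * occ D β X j ω - X j ω / D j with hR
  have hRm : Measurable R :=
    ((hX.measurable_occ_cast j).const_mul β).sub ((hX.meas j).div_const _)
  have hmean : ∫ ω, R ω ∂P = β * ∫ ω, (occ D β X j ω : ℝ) ∂P - 1 / D j := by
    rw [hR, integral_sub ((hX.integrable_occ hβ h j).const_mul β) (hXi.div_const _),
      integral_const_mul, integral_div, hX.integral_eq_one]
  have h1 := variance_le_expectation_sq (μ := P) hRm.aestronglyMeasurable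
  rw [variance_eq_integral hRm.aemeasurable, hmean] at h1
  have h2 : ∀ ω, β * centredOcc D β X P j ω - (X j ω - 1) / D j
      = R ω - (β * ∫ ω, (occ D β X j ω : ℝ) ∂P - 1 / D j) := fun ω => by
    simp only [hR, centredOcc]
    ring
  simp_rw [h2]
  refine h1.trans (le_min ?_ ?_)
  · have h3 : ∀ᵐ ω ∂P, (R ^ 2) ω ≤ β ^ 2 := by
      filter_upwards [hX.ae_nonneg j] with ω hω
      exact (sub_floor_sq_le hω hD hβ).1
    have := integral_mono_of_nonneg (ae_of_all _ fun ω => sq_nonneg (R ω))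
      (integrable_const (β ^ 2)) h3
    simpa using this
  · have h3 : ∀ᵐ ω ∂P, (R ^ 2) ω ≤ (X j ω) ^ 2 / D j ^ 2 := by
      filter_upwards [hX.ae_nonneg j] with ω hω
      have := (sub_floor_sq_le hω hD hβ).2.1
      rwa [div_pow] at this
    have := integral_mono_of_nonneg (ae_of_all _ fun ω => sq_nonneg (R ω))
      ((hX.integrable_pow j 2).div_const _) h3
    rw [integral_div, hX.integral_pow j 2] at this
    simpa [Nat.factorial] using this

lemma IsExpSeq.isCentredSeq_rounding (hX : IsExpSeq X P) (hβ : 0 < β) (h : IsSpectrum D L α) :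
    IsCentredSeq (fun j ω => β * centredOcc D β X P j ω - (X j ω - 1) / D j) P where
  meas j := (((hX.isCentredSeq_occ hβ h).meas j).const_mul β).sub ((hX.isCentredSeq_div D).meas j)
  memLp j := (((hX.isCentredSeq_occ hβ h).memLp j).const_mul β).sub
    ((hX.isCentredSeq_div D).memLp j)
  indep := hX.indep.comp (fun j x =>
    β * ((⌊x / (β * D j)⌋₊ : ℝ) - ∫ ω', (occ D β X j ω' : ℝ) ∂P) - (x - 1) / D j) fun j =>
      ((((measurable_from_top (f := fun n : ℕ => (n : ℝ))).comp
        (measurable_floor_div (β * D j))).sub_const _).const_mul β).sub (by fun_prop)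
  mean j := by
    rw [integral_sub ((((hX.isCentredSeq_occ hβ h).memLp j).const_mul β).integrable one_le_two)
      (((hX.isCentredSeq_div D).memLp j).integrable one_le_two), integral_const_mul,
      (hX.isCentredSeq_occ hβ h).mean, (hX.isCentredSeq_div D).mean]
    simp

lemma IsSpectrum.summable_two_div_sq (h : IsSpectrum D L α) (hα : α < 2) :
    Summable fun j => 2 / D j ^ 2 := by
  exact ((h.summable_inv_sq hα).mul_left 2).congr fun j => by rw [mul_one_div]

lemma IsSpectrum.summable_min (h : IsSpectrum D L α) (hα : α < 2) (β : ℝ) :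
    Summable fun j => min (β ^ 2) (2 / D j ^ 2) :=
  Summable.of_nonneg_of_le (fun j => le_min (sq_nonneg _) (by positivity))
    (fun j => min_le_right _ _) (h.summable_two_div_sq hα)

lemma IsSpectrum.tendsto_tsum_min (h : IsSpectrum D L α) (hα : α < 2) :
    Tendsto (fun β : ℝ => ∑' j, min (β ^ 2) (2 / D j ^ 2)) (𝓝[>] 0) (𝓝 0) := by
  rw [show (0 : ℝ) = ∑' _ : ℕ, (0 : ℝ) by simp]
  refine tendsto_tsum_of_dominated_convergence (h.summable_two_div_sq hα) (fun j => ?_)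
    (Eventually.of_forall fun β j => ?_)
  · have h1 : Continuous fun β : ℝ => min (β ^ 2) (2 / D j ^ 2) := by fun_prop
    have h2 := h1.tendsto 0
    rw [min_eq_left (by simpa using (by positivity : 0 ≤ 2 / D j ^ 2))] at h2
    refine Tendsto.mono_left ?_ nhdsWithin_le_nhds
    simpa using h2
  · rw [Real.norm_of_nonneg (le_min (sq_nonneg _) (by positivity))]
    exact min_le_right _ _

/-- In the exponential coupling, `β (N - 𝔼 N)` converges to `∑ (X_j - 1) / D_j` in `L²`. -/
lemma IsExpSeq.integral_total_sub_sq_le (hX : IsExpSeq X P) (hβ : 0 < β) (h : IsSpectrum D L α)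
    (hα : α < 2) {Z : Ω → ℝ}
    (hZ : ∀ᵐ ω ∂P, Tendsto (fun m => ∑ j ∈ Finset.range m, (X j ω - 1) / D j) atTop (𝓝 (Z ω))) :
    MemLp (fun ω => β * (total D β X ω - meanTotal D β) - Z ω) 2 P ∧
    ∫ ω, (β * (total D β X ω - meanTotal D β) - Z ω) ^ 2 ∂P ≤ ∑' j, min (β ^ 2) (2 / D j ^ 2) := by
  have hB : ∀ m, ∑ j ∈ Finset.range m,
      ∫ ω, (β * centredOcc D β X P j ω - (X j ω - 1) / D j) ^ 2 ∂P
        ≤ ∑' j, min (β ^ 2) (2 / D j ^ 2) := fun m =>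
    (Finset.sum_le_sum fun j _ => hX.integral_rounding_sq_le hβ h j).trans
      ((h.summable_min hα β).sum_le_tsum _ fun j _ => le_min (sq_nonneg _) (by positivity))
  have hlim : ∀ᵐ ω ∂P, Tendsto (fun m => ∑ j ∈ Finset.range m,
      (β * centredOcc D β X P j ω - (X j ω - 1) / D j)) atTop
      (𝓝 (β * (total D β X ω - meanTotal D β) - Z ω)) := by
    filter_upwards [hZ, hX.ae_tendsto_centredOcc hβ h] with ω h1 h2
    refine ((h2.const_mul β).sub h1).congr fun m => ?_
    rw [Finset.mul_sum, Finset.sum_sub_distrib]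
  have hc := hX.isCentredSeq_rounding hβ h
  exact ⟨(hc.eLpNorm_lim_le hB hlim).1, hc.integral_lim_sq_le hB hlim⟩

lemma IsExpSeq.sq_mul_integral_total_sq_le (hX : IsExpSeq X P) (hβ : 0 < β)
    (h : IsSpectrum D L α) (hα : α < 2) :
    β ^ 2 * ∫ ω, (total D β X ω - meanTotal D β) ^ 2 ∂P ≤ ∑' j, 2 / D j ^ 2 := by
  have hs := (h.summable_two_div_sq hα).mul_left (1 / β ^ 2)
  have hB : ∀ m, ∑ j ∈ Finset.range m, ∫ ω, (centredOcc D β X P j ω) ^ 2 ∂P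
        ≤ ∑' j, 1 / β ^ 2 * (2 / D j ^ 2) := fun m => by
    refine (Finset.sum_le_sum fun j _ => (hX.integral_centredOcc_sq_le j).trans ?_).trans
      (hs.sum_le_tsum _ fun j _ => by positivity)
    have h3 : ∀ᵐ ω ∂P, (occ D β X j ω : ℝ) ^ 2 ≤ 1 / β ^ 2 * ((X j ω) ^ 2 / D j ^ 2) := by
      filter_upwards [hX.ae_nonneg j] with ω hω
      have := (sub_floor_sq_le hω (h.pos j) hβ).2.2
      rw [mul_pow, div_pow] at this
      rw [one_div_mul_eq_div, le_div_iff₀ (by positivity), mul_comm]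
      exact this
    have := integral_mono_of_nonneg (ae_of_all _ fun ω => sq_nonneg _)
      (((hX.integrable_pow j 2).div_const _).const_mul _) h3
    rw [integral_const_mul, integral_div, hX.integral_pow j 2] at this
    simpa [Nat.factorial] using this
  have h1 := (hX.isCentredSeq_occ hβ h).integral_lim_sq_le hB (hX.ae_tendsto_centredOcc hβ h)
  rw [tsum_mul_left, one_div_mul_eq_div, le_div_iff₀ (by positivity), mul_comm] at h1
  exact h1

end coupling

/-! ### The canonical Gibbs measure as a conditional law -/

instance (n : ℕ) : Countable (Config n) :=
  inferInstanceAs (Countable {c : ℕ →₀ ℕ // (c.sum fun _ k => k) = n})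

lemma Config.ext {n : ℕ} {c d : Config n} (h : ∀ j, occupation c j = occupation d j) : c = d :=
  Subtype.ext (Finsupp.ext h)

/-- All levels of index at least `m + 1` are empty for large `m`. -/
lemma Config.exists_support {n : ℕ} (c : Config n) :
    ∃ M, ∀ m, M ≤ m → c.1.support ⊆ Finset.range (m + 1) := by
  obtain ⟨M, hM⟩ := c.1.support.exists_nat_subset_range
  exact ⟨M, fun m hm => hM.trans (Finset.range_subset_range.2 (by omega))⟩

lemma Config.sum_occupation {n : ℕ} (c : Config n) {m : ℕ}
    (hm : c.1.support ⊆ Finset.range (m + 1)) :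
    ∑ j ∈ Finset.range m, occupation c (j + 1) + occupation c 0 = n := by
  rw [← Finset.sum_range_succ' (fun j => occupation c j)]
  conv_rhs => rw [← c.2]
  rw [Finsupp.sum_of_support_subset _ hm _ (fun _ _ => rfl)]
  rfl

lemma Config.energy_eq (E : ℕ → ℝ) {n : ℕ} (c : Config n) {m : ℕ}
    (hm : c.1.support ⊆ Finset.range (m + 1)) :
    energy E c = n * E 0
      + ∑ j ∈ Finset.range m, (occupation c (j + 1) : ℝ) * (E (j + 1) - E 0) := by
  have h1 : energy E c = ∑ j ∈ Finset.range (m + 1), (occupation c j : ℝ) * E j := by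
    rw [energy, Finsupp.sum_of_support_subset _ hm _ (fun _ _ => by simp)]
    rfl
  have h2 : (n : ℝ) = ∑ j ∈ Finset.range m, (occupation c (j + 1) : ℝ) + occupation c 0 := by
    exact_mod_cast (c.sum_occupation hm).symm
  rw [h1, Finset.sum_range_succ', h2]
  simp only [mul_sub, Finset.sum_sub_distrib, ← Finset.sum_mul]
  ring

lemma Config.eq_of_excited {n : ℕ} {c d : Config n}
    (h : ∀ j, occupation c (j + 1) = occupation d (j + 1)) : c = d := by
  obtain ⟨M, hM⟩ := c.exists_support
  obtain ⟨M', hM'⟩ := d.exists_support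
  have h1 := c.sum_occupation (hM _ (le_max_left M M'))
  have h2 := d.sum_occupation (hM' _ (le_max_right M M'))
  simp_rw [h] at h1
  refine Config.ext fun j => ?_
  cases j with
  | zero => omega
  | succ j => exact h j

section

variable {Ω : Type*} {X : ℕ → Ω → ℝ} {E : ℕ → ℝ} {β : ℝ} {n : ℕ}

/-- The excitation energies above the ground state. -/
def excitation (E : ℕ → ℝ) (j : ℕ) : ℝ := E (j + 1) - E 0

/-- The event that the excited levels are occupied as in the configuration `c`. -/
def occEvent (E : ℕ → ℝ) (β : ℝ) (X : ℕ → Ω → ℝ) (c : Config n) : Set Ω :=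
  {ω | ∀ j, occ (excitation E) β X j ω = occupation c (j + 1)}

/-- The event that there are at most `n` excited particles. -/
def feasible (E : ℕ → ℝ) (β : ℝ) (X : ℕ → Ω → ℝ) (n : ℕ) : Set Ω :=
  {ω | ∃ c : Config n, ω ∈ occEvent E β X c}

open Classical in
/-- On the event `feasible`, the configuration of `n` particles in which the excited levels are
occupied according to the independent occupation numbers. -/
noncomputable def config (E : ℕ → ℝ) (β : ℝ) (X : ℕ → Ω → ℝ) (n : ℕ) (ω : Ω) : Config n :=
  if h : ω ∈ feasible E β X n then h.choose else groundConfig n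

lemma config_eq {ω : Ω} {c : Config n} (h : ω ∈ occEvent E β X c) : config E β X n ω = c := by
  have hf : ω ∈ feasible E β X n := ⟨c, h⟩
  rw [config, dif_pos hf]
  exact Config.eq_of_excited fun j => by rw [← hf.choose_spec j, h j]

lemma mem_occEvent_config {ω : Ω} (h : ω ∈ feasible E β X n) :
    ω ∈ occEvent E β X (config E β X n ω) := by
  obtain ⟨c, hc⟩ := h
  rwa [config_eq hc]

lemma feasible_inter_config (c : Config n) :
    feasible E β X n ∩ config E β X n ⁻¹' {c} = occEvent E β X c := by
  ext ω
  constructor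
  · rintro ⟨h1, h2⟩
    have := mem_occEvent_config h1
    rwa [show config E β X n ω = c from h2] at this
  · exact fun h => ⟨⟨c, h⟩, config_eq h⟩

lemma feasible_eq_iUnion : feasible E β X n = ⋃ c : Config n, occEvent E β X c := by
  ext ω
  simp [feasible]

lemma total_eq_of_mem_occEvent {ω : Ω} {c : Config n} (h : ω ∈ occEvent E β X c) :
    total (excitation E) β X ω = n - occupation c 0 := by
  obtain ⟨M, hM⟩ := c.exists_support
  have h1 := c.sum_occupation (hM M le_rfl)
  have h2 : total (excitation E) β X ω = ∑ j ∈ Finset.range M, (occupation c (j + 1) : ℝ) := by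
    rw [total, tsum_eq_sum (s := Finset.range M)]
    · exact Finset.sum_congr rfl fun j _ => by rw [h j]
    · intro j hj
      rw [h j]
      by_contra hne
      have hne' : c.1 (j + 1) ≠ 0 := fun h0 => hne (by simp [occupation, h0])
      have := hM M le_rfl (Finsupp.mem_support_iff.2 hne')
      simp at this hj
      omega
  rw [h2, eq_sub_iff_add_eq]
  exact_mod_cast h1

lemma occupation_config_zero {ω : Ω} (h : ω ∈ feasible E β X n) :
    (occupation (config E β X n ω) 0 : ℝ) = n - total (excitation E) β X ω := by
  rw [total_eq_of_mem_occEvent (mem_occEvent_config h)]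
  ring

lemma mem_feasible {ω : Ω} (hs : Summable fun j => (occ (excitation E) β X j ω : ℝ))
    (hn : total (excitation E) β X ω ≤ n) : ω ∈ feasible E β X n := by
  set f : ℕ → ℕ := fun j => occ (excitation E) β X j ω with hf
  have h1 := hs.tendsto_atTop_zero.eventually (gt_mem_nhds one_pos)
  obtain ⟨m, hm⟩ := eventually_atTop.1 h1
  have hm0 : ∀ j, m ≤ j → f j = 0 := fun j hj => by
    have : (f j : ℝ) < 1 := hm j hj
    exact Nat.lt_one_iff.1 (by exact_mod_cast this)
  have h2 : total (excitation E) β X ω = ((∑ j ∈ Finset.range m, f j : ℕ) : ℝ) := by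
    rw [total, tsum_eq_sum (s := Finset.range m)]
    · push_cast; rfl
    · intro j hj
      simp only [Finset.mem_range, not_lt] at hj
      exact_mod_cast hm0 j hj
  rw [h2] at hn
  have hn' : ∑ j ∈ Finset.range m, f j ≤ n := by exact_mod_cast hn
  set g : ℕ → ℕ := fun i => Nat.casesOn i (n - ∑ j ∈ Finset.range m, f j) f with hg
  have hsupp : ∀ i, g i ≠ 0 → i ∈ Finset.range (m + 1) := fun i hi => by
    cases i with
    | zero => simp
    | succ i =>
      by_contra hcon
      simp only [Finset.mem_range, not_lt] at hcon
      exact hi (hm0 i (by omega))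
  refine ⟨⟨Finsupp.onFinset (Finset.range (m + 1)) g hsupp, ?_⟩, fun j => rfl⟩
  rw [Finsupp.sum_of_support_subset _ Finsupp.support_onFinset_subset _ (fun _ _ => rfl)]
  simp only [Finsupp.onFinset_apply]
  rw [Finset.sum_range_succ']
  change ∑ j ∈ Finset.range m, f j + (n - ∑ j ∈ Finset.range m, f j) = n
  omega

variable [MeasurableSpace Ω] {P : Measure Ω} {L α : ℝ}

lemma IsExpSeq.measurableSet_occEvent (hX : IsExpSeq X P) (c : Config n) :
    MeasurableSet (occEvent E β X c) := by
  have : occEvent E β X c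
      = ⋂ j, occ (excitation E) β X j ⁻¹' {occupation c (j + 1)} := by
    ext ω; simp [occEvent]
  rw [this]
  exact MeasurableSet.iInter fun j => hX.measurable_occ j (measurableSet_singleton _)

lemma IsExpSeq.measurableSet_feasible (hX : IsExpSeq X P) :
    MeasurableSet (feasible E β X n) := by
  rw [feasible_eq_iUnion]
  exact MeasurableSet.iUnion fun c => hX.measurableSet_occEvent c

lemma IsExpSeq.measurable_config (hX : IsExpSeq X P) : Measurable (config E β X n) := by
  refine measurable_to_countable' fun c => ?_
  have h1 : config E β X n ⁻¹' {c} = (feasible E β X n ∩ config E β X n ⁻¹' {c})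
      ∪ ((feasible E β X n)ᶜ ∩ {_ω | groundConfig n = c}) := by
    ext ω
    by_cases h : ω ∈ feasible E β X n
    · simp [h]
    · simp [h, config]
  rw [h1, feasible_inter_config]
  exact (hX.measurableSet_occEvent c).union
    (hX.measurableSet_feasible.compl.inter (MeasurableSet.const _))

variable [IsProbabilityMeasure P]

/-- The probability of a configuration of the excited levels is proportional to its Boltzmann
weight, the factor being the probability that all excited levels are empty. -/
lemma IsExpSeq.measureReal_occEvent (hX : IsExpSeq X P) (hβ : 0 < β)
    (h : IsSpectrum (excitation E) L α) (c : Config n) :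
    P.real (occEvent E β X c)
      = P.real (occEvent E β X (groundConfig 0)) * Real.exp (-β * (energy E c - n * E 0)) := by
  have hlim : ∀ (k : ℕ) (d : Config k), Tendsto (fun m => ∏ j ∈ Finset.range m,
      P.real (occ (excitation E) β X j ⁻¹' {occupation d (j + 1)})) atTop
      (𝓝 (P.real (occEvent E β X d))) := fun k d => by
    have h1 : occEvent E β X d = ⋂ m : ℕ, ⋂ j ∈ Finset.range m,
        occ (excitation E) β X j ⁻¹' {occupation d (j + 1)} := by
      ext ω
      simp only [occEvent, Set.mem_ofPred_eq, Set.mem_iInter, Finset.mem_range, Set.mem_preimage,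
        Set.mem_singleton_iff]
      exact ⟨fun hω _ j _ => hω j, fun hω j => hω (j + 1) j (Nat.lt_succ_self j)⟩
    have h2 : ∀ m : ℕ, MeasurableSet (⋂ j ∈ Finset.range m,
        occ (excitation E) β X j ⁻¹' {occupation d (j + 1)}) := fun m =>
      Finset.measurableSet_biInter _ fun j _ => hX.measurable_occ j (measurableSet_singleton _)
    have h3 := tendsto_measure_iInter_atTop (μ := P) (fun m => (h2 m).nullMeasurableSet)
      (fun a b hab => Set.biInter_subset_biInter_left
        (by exact_mod_cast Finset.range_subset_range.2 hab)) ⟨0, measure_ne_top _ _⟩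
    rw [← h1] at h3
    refine ((ENNReal.tendsto_toReal (measure_ne_top _ _)).comp h3).congr fun m => ?_
    have h4 := hX.iIndepFun_occ (D := excitation E) (β := β) |>.measure_inter_preimage_eq_mul
      (Finset.range m) (sets := fun j => {occupation d (j + 1)})
      (fun j _ => measurableSet_singleton _)
    simp only [Function.comp, h4, ENNReal.toReal_prod]
    rfl
  have hsingle : ∀ j k, P.real (occ (excitation E) β X j ⁻¹' {k})
      = Real.exp (-(β * excitation E j)) ^ k * (1 - Real.exp (-(β * excitation E j))) :=
    fun j k => by
      rw [← map_measureReal_apply (hX.measurable_occ j) (measurableSet_singleton k),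
        (hX.hasLaw_occ hβ h j).map_eq, geometricMeasure_real_singleton
          (geomParam_ne_zero _), coe_geomParam, sub_sub_cancel]
  refine tendsto_nhds_unique (hlim n c) ?_
  refine ((hlim 0 (groundConfig 0)).mul_const _).congr' ?_
  obtain ⟨M, hM⟩ := c.exists_support
  filter_upwards [eventually_ge_atTop M] with m hm
  rw [c.energy_eq E (hM m hm), add_sub_cancel_left, Finset.mul_sum, Real.exp_sum,
    ← Finset.prod_mul_distrib]
  refine Finset.prod_congr rfl fun j _ => ?_
  have h0 : occupation (groundConfig 0) (j + 1) = 0 := by simp [occupation, groundConfig]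
  rw [hsingle, hsingle, h0, pow_zero, one_mul, mul_comm, ← Real.exp_nat_mul]
  congr 2
  simp only [excitation]
  ring

lemma IsExpSeq.measure_occEvent (hX : IsExpSeq X P) (hβ : 0 < β)
    (h : IsSpectrum (excitation E) L α) (c : Config n) :
    P (occEvent E β X c) = P (occEvent E β X (groundConfig 0)) *
      ENNReal.ofReal (Real.exp (β * (n * E 0))) * boltzmannWeight E n β c := by
  rw [boltzmannWeight, mul_assoc, ← ENNReal.ofReal_mul (Real.exp_pos _).le, ← Real.exp_add,
    ← ofReal_measureReal, hX.measureReal_occEvent hβ h, ENNReal.ofReal_mul measureReal_nonneg,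
    ofReal_measureReal]
  congr 3
  ring

lemma IsExpSeq.measure_feasible (hX : IsExpSeq X P) (hβ : 0 < β)
    (h : IsSpectrum (excitation E) L α) :
    P (feasible E β X n) = P (occEvent E β X (groundConfig 0)) *
      ENNReal.ofReal (Real.exp (β * (n * E 0))) * partitionFunction E n β := by
  rw [feasible_eq_iUnion, measure_iUnion _ fun c => hX.measurableSet_occEvent c,
    partitionFunction, ← ENNReal.tsum_mul_left]
  · exact tsum_congr fun c => hX.measure_occEvent hβ h c
  · intro c d hcd
    refine Set.disjoint_left.2 fun ω hc hd => hcd ?_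
    rw [← config_eq hc, config_eq hd]

/-- Almost surely there are finitely many excited particles, hence all excited levels are empty
with positive probability. -/
lemma IsExpSeq.measure_occEvent_ground_ne_zero (hX : IsExpSeq X P) (hβ : 0 < β)
    (h : IsSpectrum (excitation E) L α) : P (occEvent E β X (groundConfig 0)) ≠ 0 := by
  intro h0
  have h1 : ∀ n, ∀ᵐ ω ∂P, ω ∉ feasible E β X n := fun n => by
    rw [← measure_eq_zero_iff_ae_notMem, feasible_eq_iUnion, measure_iUnion_null_iff]
    intro c
    rw [hX.measure_occEvent hβ h, h0, zero_mul, zero_mul]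
  obtain ⟨ω, hω1, hω2⟩ := ((ae_all_iff.2 h1).and (hX.ae_summable_occ hβ h)).exists
  obtain ⟨n, hn⟩ := exists_nat_ge (total (excitation E) β X ω)
  exact hω1 n (mem_feasible hω2 hn)

lemma IsExpSeq.partitionFunction_ne_top (hX : IsExpSeq X P) (hβ : 0 < β)
    (h : IsSpectrum (excitation E) L α) (n : ℕ) : partitionFunction E n β ≠ ∞ := by
  intro htop
  have h1 := hX.measure_feasible (n := n) hβ h
  rw [htop, ENNReal.mul_top] at h1
  · exact measure_ne_top _ _ h1
  · refine mul_ne_zero (hX.measure_occEvent_ground_ne_zero hβ h) ?_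
    simpa using Real.exp_pos _

lemma IsExpSeq.measure_feasible_ne_zero (hX : IsExpSeq X P) (hβ : 0 < β)
    (h : IsSpectrum (excitation E) L α) : P (feasible E β X n) ≠ 0 := by
  rw [hX.measure_feasible hβ h]
  refine mul_ne_zero (mul_ne_zero (hX.measure_occEvent_ground_ne_zero hβ h) ?_)
    (tsum_boltzmannWeight_ne_zero E n β)
  simpa using Real.exp_pos _

/-- The canonical Gibbs measure is the law of the independent occupation numbers conditioned on
there being at most `n` excited particles. -/
lemma IsExpSeq.gibbsMeasure_eq (hX : IsExpSeq X P) (hβ : 0 < β)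
    (h : IsSpectrum (excitation E) L α) :
    gibbsMeasure E n β = (ProbabilityTheory.cond P (feasible E β X n)).map (config E β X n) := by
  have hZ := hX.partitionFunction_ne_top hβ h n
  refine Measure.ext_of_singleton fun c => ?_
  have hs : MeasurableSet ({c} : Set (Config n)) := MeasurableSpace.measurableSet_top
  rw [Measure.map_apply hX.measurable_config hs, cond_apply hX.measurableSet_feasible,
    feasible_inter_config, gibbsMeasure, PMF.toMeasure_apply_singleton _ _ hs, gibbs,
    dif_pos (show (∑' c, boltzmannWeight E n β c) ≠ ∞ from hZ), PMF.normalize_apply,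
    hX.measure_feasible hβ h, hX.measure_occEvent hβ h c]
  set K := P (occEvent E β X (groundConfig 0)) * ENNReal.ofReal (Real.exp (β * (n * E 0)))
    with hK
  have hK0 : K ≠ 0 := mul_ne_zero (hX.measure_occEvent_ground_ne_zero hβ h)
    (by simpa using Real.exp_pos _)
  have hKt : K ≠ ∞ := ENNReal.mul_ne_top (measure_ne_top _ _) ENNReal.ofReal_ne_top
  change boltzmannWeight E n β c * (partitionFunction E n β)⁻¹ = _
  rw [ENNReal.mul_inv (Or.inl hK0) (Or.inl hKt)]
  calc _ = (K⁻¹ * K) * (boltzmannWeight E n β c * (partitionFunction E n β)⁻¹) := by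
        rw [ENNReal.inv_mul_cancel hK0 hKt, one_mul]
    _ = _ := by ring

end

/-! ### From independent occupation numbers to the canonical measure -/

section transfer

variable {Ω : Type*} [MeasurableSpace Ω] {P : Measure Ω}
  {X : ℕ → Ω → ℝ} {E : ℕ → ℝ} {L α β : ℝ} {n : ℕ}

lemma integral_cond_eq {F : Type*} [NormedAddCommGroup F] [NormedSpace ℝ F] (A : Set Ω)
    (f : Ω → F) : ∫ ω, f ω ∂(ProbabilityTheory.cond P A) = (P.real A)⁻¹ • ∫ ω in A, f ω ∂P := by
  rw [ProbabilityTheory.cond, integral_smul_measure, ENNReal.toReal_inv]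
  rfl

variable [IsProbabilityMeasure P]

lemma IsExpSeq.integrable_total (hX : IsExpSeq X P) (hβ : 0 < β)
    (h : IsSpectrum (excitation E) L α) :
    Integrable (fun ω => total (excitation E) β X ω - meanTotal (excitation E) β) P :=
  (hX.memLp_total hβ h).1.integrable one_le_two

/-- The shift of the mean excitation number caused by conditioning on `feasible`. -/
noncomputable def meanShift (E : ℕ → ℝ) (β : ℝ) (X : ℕ → Ω → ℝ) (P : Measure Ω) (n : ℕ) : ℝ :=
  ∫ ω, (total (excitation E) β X ω - meanTotal (excitation E) β)
    ∂(ProbabilityTheory.cond P (feasible E β X n))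

lemma IsExpSeq.centeredN0_config (hX : IsExpSeq X P) (hβ : 0 < β)
    (h : IsSpectrum (excitation E) L α) {ω : Ω} (hω : ω ∈ feasible E β X n) :
    centeredN0 E n β (config E β X n ω)
      = meanShift E β X P n - (total (excitation E) β X ω - meanTotal (excitation E) β) := by
  have hpr : IsProbabilityMeasure (ProbabilityTheory.cond P (feasible E β X n)) :=
    cond_isProbabilityMeasure (hX.measure_feasible_ne_zero hβ h)
  have hi : Integrable (fun ω => total (excitation E) β X ω - meanTotal (excitation E) β)
      (ProbabilityTheory.cond P (feasible E β X n)) := by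
    unfold ProbabilityTheory.cond
    exact (hX.integrable_total hβ h).restrict.smul_measure
      (ENNReal.inv_ne_top.2 (hX.measure_feasible_ne_zero hβ h))
  have h1 : ∫ c, (occupation c 0 : ℝ) ∂(gibbsMeasure E n β)
      = n - meanTotal (excitation E) β - meanShift E β X P n := by
    rw [hX.gibbsMeasure_eq hβ h, integral_map hX.measurable_config.aemeasurable
      (StronglyMeasurable.of_discrete).aestronglyMeasurable, meanShift]
    have h2 : ∀ᵐ ω ∂(ProbabilityTheory.cond P (feasible E β X n)),
        (occupation (config E β X n ω) 0 : ℝ) = (n - meanTotal (excitation E) β)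
          - (total (excitation E) β X ω - meanTotal (excitation E) β) := by
      filter_upwards [ae_cond_mem hX.measurableSet_feasible] with ω hω
      rw [occupation_config_zero hω]
      ring
    rw [integral_congr_ae h2, integral_sub (integrable_const _) hi]
    simp
  rw [centeredN0, h1, occupation_config_zero hω]
  ring

lemma IsExpSeq.measureReal_feasible_compl_le (hX : IsExpSeq X P) (hβ : 0 < β)
    (h : IsSpectrum (excitation E) L α) (hn : meanTotal (excitation E) β < n) :
    P.real (feasible E β X n)ᶜ
      ≤ (∫ ω, (total (excitation E) β X ω - meanTotal (excitation E) β) ^ 2 ∂P)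
        / (n - meanTotal (excitation E) β) ^ 2 := by
  have hA := (hX.measurableSet_feasible (E := E) (β := β) (n := n)).compl
  rw [le_div_iff₀ (by nlinarith), ← smul_eq_mul, ← integral_indicator_const _ hA]
  refine integral_mono_ae ((integrable_const _).indicator hA)
    (hX.memLp_total hβ h).1.integrable_sq ?_
  filter_upwards [hX.ae_summable_occ hβ h] with ω hω
  by_cases hmem : ω ∈ feasible E β X n
  · rw [Set.indicator_of_notMem (by simpa using hmem)]
    positivity
  · rw [Set.indicator_of_mem (by simpa using hmem)]
    have : (n : ℝ) < total (excitation E) β X ω := by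
      by_contra hle
      exact hmem (mem_feasible hω (not_lt.1 hle))
    nlinarith

/-- Conditioning shifts the mean by little: `𝔼 (N - m) = 0`, so the shift only sees the complement
of `feasible`. -/
lemma IsExpSeq.abs_meanShift_le (hX : IsExpSeq X P) (hβ : 0 < β)
    (h : IsSpectrum (excitation E) L α) {δ : ℝ} (hδ : 0 < δ) :
    |meanShift E β X P n| ≤ (P.real (feasible E β X n))⁻¹ *
      (δ * ∫ ω, (total (excitation E) β X ω - meanTotal (excitation E) β) ^ 2 ∂P
        + P.real (feasible E β X n)ᶜ / δ) := by
  have hA := hX.measurableSet_feasible (E := E) (β := β) (n := n)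
  set f : Ω → ℝ := fun ω => total (excitation E) β X ω - meanTotal (excitation E) β with hf
  have hfi : Integrable f P := hX.integrable_total hβ h
  have hf2 : Integrable (fun ω => f ω ^ 2) P := (hX.memLp_total hβ h).1.integrable_sq
  have h0 : ∫ ω, f ω ∂P = 0 := by
    have hi := hX.integral_total hβ h
    have ht : Integrable (total (excitation E) β X) P := by
      have := hfi.add (integrable_const (meanTotal (excitation E) β))
      refine this.congr (ae_of_all _ fun ω => ?_)
      simp [hf]
    rw [hf, integral_sub ht (integrable_const _), hi]
    simp
  have h1 : ∫ ω in feasible E β X n, f ω ∂P = -∫ ω in (feasible E β X n)ᶜ, f ω ∂P := by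
    have := integral_add_compl hA hfi
    rw [h0] at this
    linarith
  rw [meanShift, integral_cond_eq, h1, smul_eq_mul, abs_mul,
    abs_of_nonneg (inv_nonneg.2 measureReal_nonneg), abs_neg]
  refine mul_le_mul_of_nonneg_left ?_ (inv_nonneg.2 measureReal_nonneg)
  calc |∫ ω in (feasible E β X n)ᶜ, f ω ∂P| ≤ ∫ ω in (feasible E β X n)ᶜ, |f ω| ∂P :=
        abs_integral_le_integral_abs
    _ ≤ ∫ ω in (feasible E β X n)ᶜ, (δ * f ω ^ 2 + 1 / δ) ∂P := by
        refine integral_mono_ae hfi.abs.restrict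
          ((hf2.const_mul δ).add (integrable_const _)).restrict (ae_of_all _ fun ω => ?_)
        have h2 : δ * (f ω ^ 2) + 1 / δ - 2 * |f ω| = δ * (|f ω| - 1 / δ) ^ 2 := by
          rw [← sq_abs (f ω)]
          field_simp
          ring
        have h3 : 0 ≤ δ * (|f ω| - 1 / δ) ^ 2 := by positivity
        have h4 := abs_nonneg (f ω)
        change |f ω| ≤ δ * f ω ^ 2 + 1 / δ
        linarith
    _ = δ * ∫ ω in (feasible E β X n)ᶜ, f ω ^ 2 ∂P + P.real (feasible E β X n)ᶜ / δ := by
        rw [integral_add (hf2.const_mul δ).restrict (integrable_const _), integral_const_mul,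
          setIntegral_const, smul_eq_mul, mul_one_div]
    _ ≤ _ := by
        gcongr δ * ?_ + _
        exact setIntegral_le_integral hf2 (ae_of_all _ fun ω => sq_nonneg _)

lemma IsExpSeq.charFun_gibbs (hX : IsExpSeq X P) (hβ : 0 < β)
    (h : IsSpectrum (excitation E) L α) (s u : ℝ) :
    charFun ((gibbsMeasure E n β).map fun c => centeredN0 E n β c / s) u
      = Complex.exp (u * (meanShift E β X P n / s : ℝ) * Complex.I) *
        ((P.real (feasible E β X n))⁻¹ • ∫ ω in feasible E β X n, Complex.exp ((-u : ℝ) *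
          ((total (excitation E) β X ω - meanTotal (excitation E) β) / s : ℝ) * Complex.I) ∂P) := by
  have hA := hX.measurableSet_feasible (E := E) (β := β) (n := n)
  have hm : Measurable fun c : Config n => centeredN0 E n β c / s := fun _ _ =>
    MeasurableSpace.measurableSet_top
  rw [charFun_apply_real, integral_map hm.aemeasurable (by fun_prop), hX.gibbsMeasure_eq hβ h,
    integral_map hX.measurable_config.aemeasurable
      (StronglyMeasurable.of_discrete).aestronglyMeasurable, integral_cond_eq, mul_smul_comm,
    ← integral_const_mul]
  congr 1
  refine setIntegral_congr_fun hA fun ω hω => ?_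
  rw [hX.centeredN0_config hβ h hω, ← Complex.exp_add]
  congr 1
  push_cast
  ring

lemma measurable_centeredN0_div (E : ℕ → ℝ) (n : ℕ) (β s : ℝ) :
    Measurable fun c : Config n => centeredN0 E n β c / s := fun _ _ =>
  MeasurableSpace.measurableSet_top

/-- If the condensate is macroscopic (`m / n → ρ < 1`), the fluctuations of the ground state
occupation under the canonical measure are, up to sign, those of the number of excited particles
when the occupation numbers are independent. -/
lemma IsExpSeq.tendsto_charFun_gibbs (hX : IsExpSeq X P) (h : IsSpectrum (excitation E) L α)
    {b s : ℕ → ℝ} (hb : ∀ᶠ n in atTop, 0 < b n) (hs : ∀ᶠ n in atTop, 0 < s n)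
    (hs0 : Tendsto (fun n : ℕ => s n / n) atTop (𝓝 0)) {ρ : ℝ} (hρ : ρ < 1)
    (hm : Tendsto (fun n : ℕ => meanTotal (excitation E) (b n) / n) atTop (𝓝 ρ)) {C : ℝ}
    (hV : ∀ᶠ n in atTop, ∫ ω, (total (excitation E) (b n) X ω -
      meanTotal (excitation E) (b n)) ^ 2 ∂P ≤ C * s n ^ 2) {φ : ℝ → ℂ}
    (hφ : ∀ u : ℝ, Tendsto (fun n : ℕ => ∫ ω, Complex.exp (u * ((total (excitation E) (b n) X ω -
      meanTotal (excitation E) (b n)) / s n : ℝ) * Complex.I) ∂P) atTop (𝓝 (φ u))) (u : ℝ) :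
    Tendsto (fun n : ℕ => charFun ((gibbsMeasure E n (b n)).map fun c =>
      centeredN0 E n (b n) c / s n) u) atTop (𝓝 (φ (-u))) := by
  set q : ℕ → ℝ := fun n => P.real (feasible E (b n) X n)ᶜ with hq
  have hq0 : ∀ n, 0 ≤ q n := fun n => measureReal_nonneg
  have hPA : ∀ n, P.real (feasible E (b n) X n) = 1 - q n := fun n => by
    rw [hq, ← probReal_compl_eq_one_sub hX.measurableSet_feasible.compl, compl_compl]
  -- the canonical ensemble is feasible with high probability
  have hqlim : Tendsto q atTop (𝓝 0) := by
    have hlim : Tendsto (fun n : ℕ => C * (s n / n) ^ 2 / (1 - meanTotal (excitation E) (b n) / n)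
        ^ 2) atTop (𝓝 (C * 0 ^ 2 / (1 - ρ) ^ 2)) :=
      ((hs0.pow 2).const_mul C).div ((hm.const_sub 1).pow 2)
        (pow_ne_zero 2 (by linarith))
    rw [zero_pow two_ne_zero, mul_zero, zero_div] at hlim
    refine tendsto_of_tendsto_of_tendsto_of_le_of_le' tendsto_const_nhds hlim
      (Eventually.of_forall hq0) ?_
    filter_upwards [hb, hV, hm.eventually (gt_mem_nhds hρ), eventually_gt_atTop 0]
      with n hb hV hm hn
    have hn' : (0 : ℝ) < n := by exact_mod_cast hn
    have hlt : meanTotal (excitation E) (b n) < n := by rwa [div_lt_one hn'] at hm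
    refine (hX.measureReal_feasible_compl_le hb h hlt).trans ?_
    have h1 : (n : ℝ) - meanTotal (excitation E) (b n)
        = n * (1 - meanTotal (excitation E) (b n) / n) := by field_simp
    rw [h1, mul_pow, div_pow, ← mul_div_assoc, div_div]
    gcongr
  have hPAlim : Tendsto (fun n => (P.real (feasible E (b n) X n))⁻¹) atTop (𝓝 1) := by
    simp_rw [hPA]
    have := (hqlim.const_sub 1).inv₀ (by norm_num)
    simpa using this
  have hshift : Tendsto (fun n => meanShift E (b n) X P n / s n) atTop (𝓝 0) := by
    set δ : ℕ → ℝ := fun n => √(q n) + 1 / ((n : ℝ) + 1) with hδ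
    have hsq : Tendsto (fun n => √(q n)) atTop (𝓝 0) := by simpa using hqlim.sqrt
    have hδlim : Tendsto δ atTop (𝓝 0) := by
      simpa only [add_zero] using hsq.add (tendsto_one_div_add_atTop_nhds_zero_nat (𝕜 := ℝ))
    have hδ0 : ∀ n, 0 < δ n := fun n => by
      have : (0 : ℝ) < 1 / ((n : ℝ) + 1) := by positivity
      have := Real.sqrt_nonneg (q n)
      simp only [hδ]
      linarith
    have hlim := hPAlim.mul ((hδlim.mul_const C).add hsq)
    rw [zero_mul, add_zero, mul_zero] at hlim
    rw [tendsto_zero_iff_abs_tendsto_zero]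
    refine tendsto_of_tendsto_of_tendsto_of_le_of_le' tendsto_const_nhds hlim
      (Eventually.of_forall fun n => abs_nonneg _) ?_
    filter_upwards [hb, hs, hV] with n hb hs hV
    have h1 := hX.abs_meanShift_le (n := n) hb h (δ := δ n / s n) (div_pos (hδ0 n) hs)
    simp only [Function.comp]
    rw [abs_div, abs_of_pos hs, div_le_iff₀ hs]
    refine h1.trans ?_
    rw [mul_assoc]
    refine mul_le_mul_of_nonneg_left ?_ (inv_nonneg.2 measureReal_nonneg)
    have h2 : δ n / s n * ∫ ω, (total (excitation E) (b n) X ω -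
        meanTotal (excitation E) (b n)) ^ 2 ∂P ≤ δ n * C * s n := by
      have := hδ0 n
      calc _ ≤ δ n / s n * (C * s n ^ 2) := by gcongr
        _ = _ := by field_simp
    have h3 : q n / (δ n / s n) ≤ √(q n) * s n := by
      have h4 := hδ0 n
      rw [div_div_eq_mul_div, div_le_iff₀ h4, mul_right_comm]
      refine mul_le_mul_of_nonneg_right ?_ hs.le
      calc q n = √(q n) * √(q n) := (Real.mul_self_sqrt (hq0 n)).symm
        _ ≤ √(q n) * δ n := by
          gcongr
          have : (0 : ℝ) < 1 / ((n : ℝ) + 1) := by positivity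
          simp only [hδ]
          linarith
    rw [add_mul]
    exact add_le_add h2 h3
  have hexp : Tendsto (fun n => Complex.exp (u * (meanShift E (b n) X P n / s n : ℝ) * Complex.I))
      atTop (𝓝 1) := by
    have hc : Continuous fun x : ℝ => Complex.exp (u * (x : ℂ) * Complex.I) := by fun_prop
    have := (hc.tendsto 0).comp hshift
    rwa [Complex.ofReal_zero, mul_zero, zero_mul, Complex.exp_zero] at this
  have hint : Tendsto (fun n : ℕ => ∫ ω in feasible E (b n) X n, Complex.exp ((-u : ℝ) *
      ((total (excitation E) (b n) X ω - meanTotal (excitation E) (b n)) / s n : ℝ) * Complex.I) ∂P)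
      atTop (𝓝 (φ (-u))) := by
    have h1 : Tendsto (fun n : ℕ => ∫ ω in (feasible E (b n) X n)ᶜ, Complex.exp ((-u : ℝ) *
        ((total (excitation E) (b n) X ω - meanTotal (excitation E) (b n)) / s n : ℝ) *
          Complex.I) ∂P) atTop (𝓝 0) := by
      refine squeeze_zero_norm (fun n => ?_) hqlim
      have := norm_setIntegral_le_of_norm_le_const (μ := P) (s := (feasible E (b n) X n)ᶜ) (C := 1)
        (f := fun ω => Complex.exp ((-u : ℝ) * ((total (excitation E) (b n) X ω -
          meanTotal (excitation E) (b n)) / s n : ℝ) * Complex.I)) (measure_lt_top _ _)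
        (fun ω _ => by rw [← Complex.ofReal_mul, Complex.norm_exp_ofReal_mul_I])
      simpa using this
    have h2 := (hφ (-u)).sub h1
    rw [sub_zero] at h2
    refine h2.congr fun n => ?_
    rw [sub_eq_iff_eq_add]
    refine (integral_add_compl hX.measurableSet_feasible ?_).symm
    have hm : Measurable (total (excitation E) (b n) X) := hX.measurable_total
    refine Integrable.of_bound (C := 1) (Measurable.aestronglyMeasurable (by fun_prop))
      (ae_of_all _ fun ω => ?_)
    rw [← Complex.ofReal_mul, Complex.norm_exp_ofReal_mul_I]
  have hall := hexp.mul (hPAlim.smul hint)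
  rw [one_smul, one_mul] at hall
  refine hall.congr' ?_
  filter_upwards [hb] with n hb
  rw [hX.charFun_gibbs hb h]

lemma tendstoInDistribution_of_charFun {Ω' : Type*} [MeasurableSpace Ω'] {P' : Measure Ω'}
    [IsProbabilityMeasure P'] {Z : Ω' → ℝ} (hZ : AEMeasurable Z P') {b s : ℕ → ℝ}
    (hc : ∀ u : ℝ, Tendsto (fun n : ℕ => charFun ((gibbsMeasure E n (b n)).map fun c =>
      centeredN0 E n (b n) c / s n) u) atTop (𝓝 (charFun (P'.map Z) u))) :
    TendstoInDistribution (fun (n : ℕ) (c : Config n) => centeredN0 E n (b n) c / s n) atTop Z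
      (fun n => gibbsMeasure E n (b n)) P' where
  forall_aemeasurable n := (measurable_centeredN0_div E n (b n) (s n)).aemeasurable
  aemeasurable_limit := hZ
  tendsto := ProbabilityMeasure.tendsto_iff_tendsto_charFun.2 hc

end transfer

/-! ### Gaussian fluctuations -/

/-- Second-order Taylor bound for `exp (i x)`. -/
lemma norm_exp_mul_I_sub_le (x : ℝ) :
    ‖Complex.exp (x * Complex.I) - 1 - x * Complex.I + (x : ℂ) ^ 2 / 2‖ ≤ 4 * |x| ^ 3 := by
  have hnorm : ‖(x : ℂ) * Complex.I‖ = |x| := by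
    rw [norm_mul, Complex.norm_I, mul_one, Complex.norm_real, Real.norm_eq_abs]
  have hx0 := abs_nonneg x
  rcases le_total |x| 1 with hx | hx
  · have h1 := Complex.exp_bound (x := x * Complex.I) (by rwa [hnorm]) (n := 3) (by norm_num)
    have h2 : ∑ m ∈ Finset.range 3, ((x : ℂ) * Complex.I) ^ m / (m.factorial : ℂ)
        = 1 + x * Complex.I - (x : ℂ) ^ 2 / 2 := by
      simp [Finset.sum_range_succ, Nat.factorial, mul_pow]
      ring
    rw [h2, hnorm] at h1
    have h3 : Complex.exp (x * Complex.I) - 1 - x * Complex.I + (x : ℂ) ^ 2 / 2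
        = Complex.exp (x * Complex.I) - (1 + x * Complex.I - (x : ℂ) ^ 2 / 2) := by ring
    rw [h3]
    refine h1.trans ?_
    norm_num [Nat.factorial]
    nlinarith [pow_nonneg hx0 3]
  · have h1 : ‖(x : ℂ) ^ 2 / 2‖ = |x| ^ 2 / 2 := by simp
    have h2 : ‖Complex.exp (x * Complex.I)‖ = 1 := Complex.norm_exp_ofReal_mul_I x
    have h3 : |x| ≤ |x| ^ 3 := le_self_pow₀ hx (by norm_num)
    have h4 : |x| ^ 2 ≤ |x| ^ 3 := pow_le_pow_right₀ hx (by norm_num)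
    calc _ ≤ ‖Complex.exp (x * Complex.I)‖ + ‖(1 : ℂ)‖ + ‖(x : ℂ) * Complex.I‖
          + ‖(x : ℂ) ^ 2 / 2‖ := by
          refine (norm_add_le _ _).trans ?_
          gcongr
          refine (norm_sub_le _ _).trans ?_
          gcongr
          exact norm_sub_le _ _
      _ ≤ _ := by
        rw [h1, h2, hnorm, norm_one]
        linarith

lemma norm_levyTerm_add_le (θ : ℝ) (k : ℕ) :
    ‖levyTerm θ k + (θ ^ 2 / 2 * ((k : ℝ) + 1) : ℝ)‖ ≤ 4 * |θ| ^ 3 * ((k : ℝ) + 1) ^ 2 := by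
  have hk : (0 : ℝ) < (k : ℝ) + 1 := by positivity
  have hkc : ((k : ℝ) : ℂ) + 1 ≠ 0 := by exact_mod_cast hk.ne'
  have h1 := norm_exp_mul_I_sub_le (((k : ℝ) + 1) * θ)
  have h2 : levyTerm θ k + (θ ^ 2 / 2 * ((k : ℝ) + 1) : ℝ)
      = (Complex.exp ((((k : ℝ) + 1) * θ : ℝ) * Complex.I) - 1 - (((k : ℝ) + 1) * θ : ℝ) * Complex.I
        + ((((k : ℝ) + 1) * θ : ℝ) : ℂ) ^ 2 / 2) / (((k : ℝ) + 1 : ℝ) : ℂ) := by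
    rw [levyTerm]
    push_cast
    field_simp
  rw [h2, norm_div, Complex.norm_real, Real.norm_of_nonneg hk.le, div_le_iff₀ hk]
  refine h1.trans (le_of_eq ?_)
  rw [abs_mul, abs_of_pos hk]
  ring

section

variable {Ω : Type*} [MeasurableSpace Ω] {P : Measure Ω} [IsProbabilityMeasure P]
  {X : ℕ → Ω → ℝ} {E : ℕ → ℝ} {D : ℕ → ℝ} {L α : ℝ}

/-- The exponent of the compound Poisson characteristic function is quadratic up to a cubic
error. -/
lemma IsSpectrum.norm_tsum_levyTerm_add_le (h : IsSpectrum D L α) {β : ℝ} (hβ : 0 < β) (θ : ℝ) :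
    ‖(∑' k : ℕ, heatTrace D (((k : ℝ) + 1) * β) • levyTerm θ k) +
      ((θ ^ 2 / 2 * ∑' k : ℕ, ((k : ℝ) + 1) * heatTrace D (((k : ℝ) + 1) * β) : ℝ) : ℂ)‖
      ≤ 4 * |θ| ^ 3 * ∑' k : ℕ, ((k : ℝ) + 1) ^ 2 * heatTrace D (((k : ℝ) + 1) * β) := by
  have h1 := h.summable_pow_mul_heatTrace 1 hβ
  simp only [pow_one] at h1
  have h2 := h.summable_pow_mul_heatTrace 2 hβ
  have hs : Summable fun k : ℕ => heatTrace D (((k : ℝ) + 1) * β) • levyTerm θ k := by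
    refine Summable.of_norm_bounded (h1.mul_left (2 + |θ|)) fun k => ?_
    rw [norm_smul, Real.norm_of_nonneg (heatTrace_nonneg _ _)]
    calc _ ≤ heatTrace D (((k : ℝ) + 1) * β) * ((2 + |θ|) * ((k : ℝ) + 1)) :=
          mul_le_mul_of_nonneg_left (norm_levyTerm_le θ k) (heatTrace_nonneg _ _)
      _ = _ := by ring
  have hs' : Summable fun k : ℕ => ((θ ^ 2 / 2 * (((k : ℝ) + 1) *
      heatTrace D (((k : ℝ) + 1) * β)) : ℝ) : ℂ) :=
    Complex.ofRealCLM.summable (h1.mul_left (θ ^ 2 / 2))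
  rw [← tsum_mul_left, Complex.ofReal_tsum, ← hs.tsum_add hs']
  refine tsum_of_norm_bounded (h2.hasSum.mul_left (4 * |θ| ^ 3)) fun k => ?_
  have h3 : heatTrace D (((k : ℝ) + 1) * β) • levyTerm θ k + ((θ ^ 2 / 2 * (((k : ℝ) + 1) *
      heatTrace D (((k : ℝ) + 1) * β)) : ℝ) : ℂ) = heatTrace D (((k : ℝ) + 1) * β) •
        (levyTerm θ k + (θ ^ 2 / 2 * ((k : ℝ) + 1) : ℝ)) := by
    rw [smul_add, Complex.real_smul, Complex.real_smul]
    push_cast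
    ring
  rw [h3, norm_smul, Real.norm_of_nonneg (heatTrace_nonneg _ _)]
  calc _ ≤ heatTrace D (((k : ℝ) + 1) * β) * (4 * |θ| ^ 3 * ((k : ℝ) + 1) ^ 2) :=
        mul_le_mul_of_nonneg_left (norm_levyTerm_add_le θ k) (heatTrace_nonneg _ _)
    _ = _ := by ring

/-- Central limit theorem for the number of excited particles. -/
lemma IsExpSeq.tendsto_charFun_gaussian (hX : IsExpSeq X P) (h : IsSpectrum D L α)
    (hα : 2 ≤ α) {b s : ℕ → ℝ} (hb : ∀ᶠ n in atTop, 0 < b n) (hs : ∀ᶠ n in atTop, 0 < s n)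
    {v : ℝ} (hv : Tendsto (fun n => (∑' k : ℕ, ((k : ℝ) + 1) *
      heatTrace D (((k : ℝ) + 1) * b n)) / s n ^ 2) atTop (𝓝 v))
    (hT : Tendsto (fun n => b n ^ α * b n * s n ^ 3) atTop atTop) (u : ℝ) :
    Tendsto (fun n : ℕ => ∫ ω, Complex.exp (u * ((total D (b n) X ω -
      meanTotal D (b n)) / s n : ℝ) * Complex.I) ∂P) atTop
      (𝓝 (Complex.exp (-(v * u ^ 2 / 2 : ℝ)))) := by
  obtain ⟨C, hC, hCb⟩ := h.exists_tsum_sq_mul_heatTrace_le hα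
  set V : ℕ → ℝ := fun n => ∑' k : ℕ, ((k : ℝ) + 1) * heatTrace D (((k : ℝ) + 1) * b n) with hV
  have h1 : Tendsto (fun n => (∑' k : ℕ, heatTrace D (((k : ℝ) + 1) * b n) •
      levyTerm (u / s n) k) + (((u / s n) ^ 2 / 2 * V n : ℝ) : ℂ)) atTop (𝓝 0) := by
    have hlim := hT.const_div_atTop (4 * |u| ^ 3 * C)
    refine squeeze_zero_norm' ?_ hlim
    filter_upwards [hb, hs] with n hb hs
    refine (h.norm_tsum_levyTerm_add_le hb (u / s n)).trans ?_
    have h2 := hCb (b n) hb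
    have hbα : 0 < b n ^ α * b n := by positivity
    rw [mul_comm, ← le_div_iff₀ hbα] at h2
    rw [abs_div, abs_of_pos hs, div_pow]
    calc _ ≤ 4 * (|u| ^ 3 / s n ^ 3) * (C / (b n ^ α * b n)) := by gcongr
      _ = _ := by field_simp
  have h2 : Tendsto (fun n => (((u / s n) ^ 2 / 2 * V n : ℝ) : ℂ)) atTop
      (𝓝 ((v * u ^ 2 / 2 : ℝ) : ℂ)) := by
    refine (Complex.continuous_ofReal.tendsto _).comp ?_
    have := hv.mul_const (u ^ 2 / 2)
    rw [← mul_div_assoc] at this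
    refine this.congr fun n => ?_
    rw [div_pow]
    ring
  have h3 := (Complex.continuous_exp.tendsto _).comp (h1.sub h2)
  rw [zero_sub] at h3
  refine h3.congr' ?_
  filter_upwards [hb, hs] with n hb hs
  simp only [Function.comp, add_sub_cancel_right]
  rw [← hX.charFun_total hb h]
  refine integral_congr_ae (ae_of_all _ fun ω => ?_)
  beta_reduce
  push_cast
  ring_nf

/-- The case `α ≥ 2`: Gaussian fluctuations of the ground state occupation. -/
lemma IsExpSeq.tendstoInDistribution_gaussian (hX : IsExpSeq X P)
    (h : IsSpectrum (excitation E) L α) (hα : 2 ≤ α) {b s : ℕ → ℝ}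
    (hb : ∀ᶠ n in atTop, 0 < b n) (hs : ∀ᶠ n in atTop, 0 < s n)
    (hs0 : Tendsto (fun n : ℕ => s n / n) atTop (𝓝 0)) {ρ : ℝ} (hρ : ρ < 1)
    (hm : Tendsto (fun n : ℕ => meanTotal (excitation E) (b n) / n) atTop (𝓝 ρ))
    {v : ℝ} (hv0 : 0 ≤ v) (hv : Tendsto (fun n => (∑' k : ℕ, ((k : ℝ) + 1) *
      heatTrace (excitation E) (((k : ℝ) + 1) * b n)) / s n ^ 2) atTop (𝓝 v))
    (hT : Tendsto (fun n => b n ^ α * b n * s n ^ 3) atTop atTop) :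
    TendstoInDistribution (fun (n : ℕ) (c : Config n) => centeredN0 E n (b n) c / s n) atTop
      (fun x : ℝ => x) (fun n => gibbsMeasure E n (b n)) (gaussianReal 0 v.toNNReal) := by
  refine tendstoInDistribution_of_charFun aemeasurable_id fun u => ?_
  have hV : ∀ᶠ n in atTop, ∫ ω, (total (excitation E) (b n) X ω -
      meanTotal (excitation E) (b n)) ^ 2 ∂P ≤ 2 * (v + 1) * s n ^ 2 := by
    filter_upwards [hb, hs, hv.eventually (gt_mem_nhds (lt_add_one v))] with n hb hs hv
    refine (hX.memLp_total hb h).2.trans ?_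
    rw [div_lt_iff₀ (by positivity)] at hv
    linarith
  have := hX.tendsto_charFun_gibbs h hb hs hs0 hρ hm hV
    (hX.tendsto_charFun_gaussian h hα hb hs hv hT) u
  convert this using 2
  rw [Measure.map_id, charFun_gaussianReal, Real.coe_toNNReal _ hv0]
  push_cast
  ring_nf

/-- The case `α < 2`: the ground state occupation fluctuates like `-κ ∑ (X_j - 1) / D_j`. -/
lemma IsExpSeq.tendstoInDistribution_series (hX : IsExpSeq X P)
    (h : IsSpectrum (excitation E) L α) (hα : α < 2) {b s : ℕ → ℝ} {κ : ℝ}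
    (hb0 : Tendsto b atTop (𝓝[>] 0)) (hs : ∀ᶠ n in atTop, 0 < s n)
    (hbs : ∀ᶠ n in atTop, κ * b n * s n = 1)
    (hs0 : Tendsto (fun n : ℕ => s n / n) atTop (𝓝 0)) {ρ : ℝ} (hρ : ρ < 1)
    (hm : Tendsto (fun n : ℕ => meanTotal (excitation E) (b n) / n) atTop (𝓝 ρ)) {Z : Ω → ℝ}
    (hZm : AEMeasurable Z P)
    (hZ : ∀ᵐ ω ∂P, Tendsto (fun m => ∑ j ∈ Finset.range m, (X j ω - 1) / excitation E j) atTop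
      (𝓝 (Z ω))) :
    TendstoInDistribution (fun (n : ℕ) (c : Config n) => centeredN0 E n (b n) c / s n) atTop
      (fun ω => -κ * Z ω) (fun n => gibbsMeasure E n (b n)) P := by
  have hb : ∀ᶠ n in atTop, 0 < b n := hb0.eventually self_mem_nhdsWithin
  refine tendstoInDistribution_of_charFun (hZm.const_mul _) fun u => ?_
  have hV : ∀ᶠ n in atTop, ∫ ω, (total (excitation E) (b n) X ω -
      meanTotal (excitation E) (b n)) ^ 2 ∂P
        ≤ (κ ^ 2 * ∑' j, 2 / excitation E j ^ 2) * s n ^ 2 := by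
    filter_upwards [hb, hbs] with n hb hbs
    calc _ = (κ * b n * s n) ^ 2 * ∫ ω, (total (excitation E) (b n) X ω -
          meanTotal (excitation E) (b n)) ^ 2 ∂P := by rw [hbs]; ring
      _ = (κ * s n) ^ 2 * (b n ^ 2 * ∫ ω, (total (excitation E) (b n) X ω -
          meanTotal (excitation E) (b n)) ^ 2 ∂P) := by ring
      _ ≤ (κ * s n) ^ 2 * ∑' j, 2 / excitation E j ^ 2 := by
        gcongr
        exact hX.sq_mul_integral_total_sq_le hb h hα
      _ = _ := by ring
  have hφ : ∀ u : ℝ, Tendsto (fun n : ℕ => ∫ ω, Complex.exp (u * ((total (excitation E) (b n) X ω -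
      meanTotal (excitation E) (b n)) / s n : ℝ) * Complex.I) ∂P) atTop
      (𝓝 (∫ ω, Complex.exp ((u * (κ * Z ω) : ℝ) * Complex.I) ∂P)) := fun u => by
    have hlim : Tendsto (fun n => |u * κ| * √(∑' j, min (b n ^ 2) (2 / excitation E j ^ 2)))
        atTop (𝓝 0) := by
      have := (((h.tendsto_tsum_min hα).comp hb0).sqrt).const_mul |u * κ|
      simpa using this
    rw [tendsto_iff_norm_sub_tendsto_zero]
    refine squeeze_zero' (Eventually.of_forall fun n => norm_nonneg _) ?_ hlim
    filter_upwards [hb, hbs, hs] with n hb hbs hs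
    obtain ⟨hL, hB⟩ := hX.integral_total_sub_sq_le hb h hα hZ
    set Y : Ω → ℝ := fun ω => b n * (total (excitation E) (b n) X ω -
      meanTotal (excitation E) (b n)) - Z ω with hY
    have htm : Measurable (total (excitation E) (b n) X) := hX.measurable_total
    have hi1 : Integrable (fun ω => Complex.exp (u * ((total (excitation E) (b n) X ω -
        meanTotal (excitation E) (b n)) / s n : ℝ) * Complex.I)) P :=
      Integrable.of_bound (C := 1) (Measurable.aestronglyMeasurable (by fun_prop))
        (ae_of_all _ fun ω => by rw [← Complex.ofReal_mul, Complex.norm_exp_ofReal_mul_I])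
    have hi2 : Integrable (fun ω => Complex.exp ((u * (κ * Z ω) : ℝ) * Complex.I)) P :=
      Integrable.of_bound (C := 1) (AEMeasurable.aestronglyMeasurable (by fun_prop))
        (ae_of_all _ fun ω => by rw [Complex.norm_exp_ofReal_mul_I])
    rw [← integral_sub hi1 hi2]
    have hbound : ∀ ω, ‖Complex.exp (u * ((total (excitation E) (b n) X ω -
        meanTotal (excitation E) (b n)) / s n : ℝ) * Complex.I)
          - Complex.exp ((u * (κ * Z ω) : ℝ) * Complex.I)‖ ≤ |u * κ| * |Y ω| := fun ω => by
      have h1 : (total (excitation E) (b n) X ω - meanTotal (excitation E) (b n)) / s n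
          = κ * (Y ω + Z ω) := by
        rw [div_eq_iff hs.ne', hY]
        linear_combination -(total (excitation E) (b n) X ω - meanTotal (excitation E) (b n)) * hbs
      have h2 : Complex.exp (u * ((κ * (Y ω + Z ω) : ℝ) : ℂ) * Complex.I)
          - Complex.exp ((u * (κ * Z ω) : ℝ) * Complex.I)
          = Complex.exp ((u * (κ * Z ω) : ℝ) * Complex.I) *
            (Complex.exp (Complex.I * (u * κ * Y ω : ℝ)) - 1) := by
        rw [mul_sub, mul_one, ← Complex.exp_add]
        congr 2
        push_cast
        ring
      rw [h1, h2, norm_mul, Complex.norm_exp_ofReal_mul_I, one_mul, ← abs_mul]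
      exact Real.norm_exp_I_mul_ofReal_sub_one_le
    have hYi : Integrable (fun ω => |Y ω|) P := (hL.integrable one_le_two).abs
    have hjensen : ∫ ω, |Y ω| ∂P ≤ √(∑' j, min (b n ^ 2) (2 / excitation E j ^ 2)) := by
      refine Real.le_sqrt_of_sq_le (le_trans ?_ hB)
      have h1 := variance_eq_sub hL.abs
      have h2 := variance_nonneg |Y| P
      rw [h1] at h2
      simp only [Pi.pow_apply, Pi.abs_apply, sq_abs] at h2
      linarith
    calc _ ≤ ∫ ω, |u * κ| * |Y ω| ∂P :=
          norm_integral_le_of_norm_le (hYi.const_mul _) (ae_of_all _ hbound)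
      _ = |u * κ| * ∫ ω, |Y ω| ∂P := integral_const_mul _ _
      _ ≤ _ := by gcongr
  have := hX.tendsto_charFun_gibbs h hb hs hs0 hρ hm hV hφ u
  convert this using 2
  rw [charFun_apply_real, integral_map (hZm.const_mul _) (by fun_prop)]
  refine integral_congr_ae (ae_of_all _ fun ω => ?_)
  beta_reduce
  push_cast
  ring_nf

end

/-! ### Spectrum and temperature -/

/-- Weyl's law is not affected by dropping the ground state and shifting the energies by `E 0`. -/
lemma isSpectrum_excitation {E : ℕ → ℝ} (hE : Monotone E) (hgap : E 0 < E 1) {L α : ℝ}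
    (hL : 0 < L) (hα : 1 ≤ α) (hW : WeylLaw E L α) : IsSpectrum (excitation E) L α where
  mono i j hij := by
    have := hE (Nat.succ_le_succ hij)
    simp only [excitation]
    linarith
  pos_zero := by simp only [excitation, zero_add]; linarith
  L_pos := hL
  one_le := hα
  law := by
    have hα0 : 0 < α := by linarith
    have hshift : Tendsto (fun x : ℝ => x + E 0) atTop atTop :=
      tendsto_atTop_add_const_right _ _ tendsto_id
    have h1 := hW.comp hshift
    have h2 : Tendsto (fun x : ℝ => ((x + E 0) / x) ^ α) atTop (𝓝 1) := by
      have h3 : Tendsto (fun x : ℝ => 1 + E 0 / x) atTop (𝓝 1) := by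
        simpa using (tendsto_const_nhds (x := (1 : ℝ))).add
          (tendsto_id.const_div_atTop (E 0))
      have h4 : Tendsto (fun x : ℝ => (x + E 0) / x) atTop (𝓝 1) := by
        refine h3.congr' ?_
        filter_upwards [eventually_gt_atTop 0] with x hx
        field_simp
      simpa using h4.rpow_const (p := α) (Or.inr hα0.le)
    have h5 := ((h1.mul h2).mul_const L).sub (tendsto_rpow_neg_atTop hα0)
    simp only [mul_one, one_mul, sub_zero] at h5
    refine h5.congr' ?_
    filter_upwards [h1.eventually (lt_mem_nhds one_pos), eventually_gt_atTop 0,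
      hshift.eventually_gt_atTop 0] with x hx hx0 hx1
    have hfin : {j | E j ≤ x + E 0}.Finite := by
      refine Set.finite_of_ncard_ne_zero fun h0 => ?_
      simp [h0] at hx
    have hset : {j | E j ≤ x + E 0} = insert 0 (Nat.succ '' {j | excitation E j ≤ x}) := by
      ext j
      cases j with
      | zero => simp [hx0.le]
      | succ j => simp [excitation]
    have hfin' : {j | excitation E j ≤ x}.Finite :=
      (Set.finite_image_iff Nat.succ_injective.injOn).1
        (hfin.subset (hset ▸ Set.subset_insert _ _))
    have hcard : {j | E j ≤ x + E 0}.ncard = levelCount (excitation E) x + 1 := by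
      rw [hset, Set.ncard_insert_of_notMem (by simp) (hfin'.image _),
        Set.ncard_image_of_injective _ Nat.succ_injective, levelCount]
    have hxα : x ^ α ≠ 0 := by positivity
    have hxα' : (x + E 0) ^ α ≠ 0 := by positivity
    simp only [Function.comp, hcard]
    rw [Real.div_rpow hx1.le hx0.le, Real.rpow_neg hx0.le]
    push_cast
    field_simp
    ring

lemma spectralConst_rpow {L α : ℝ} (hL : 0 < L) (hα : 1 < α) :
    spectralConst L α ^ α = L * Real.Gamma (α + 1) * zeta α ∧ 0 < spectralConst L α := by
  have hα0 : 0 < α := by linarith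
  have hG := Real.Gamma_pos_of_pos hα0
  have hz := zeta_pos hα
  have hpos : 0 < L * α * Real.Gamma α * zeta α := by positivity
  rw [spectralConst, if_neg hα.ne', ← Real.rpow_mul hpos.le, one_div_mul_cancel hα0.ne',
    Real.rpow_one, Real.Gamma_add_one hα0.ne']
  exact ⟨by ring, by positivity⟩

lemma spectralConst_pos {L α : ℝ} (hL : 0 < L) (hα : 1 ≤ α) : 0 < spectralConst L α := by
  rcases hα.eq_or_lt with h | h
  · rw [spectralConst, if_pos h.symm]; exact hL
  · exact (spectralConst_rpow hL h).2

lemma div_criticalT (kB L α t : ℝ) :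
    t / criticalT kB L α = kB * t * spectralConst L α := by
  rw [criticalT, div_div_eq_mul_div, div_one]
  ring

lemma tendsto_log_natCast : Tendsto (fun n : ℕ => Real.log n) atTop atTop :=
  Real.tendsto_log_atTop.comp tendsto_natCast_atTop_atTop

section temperature

variable {kB t α : ℝ}

lemma invTemp_eq (hα : 1 < α) (kB t : ℝ) (n : ℕ) :
    invTemp kB α t n = 1 / (kB * t * (n : ℝ) ^ (1 / α)) := by
  rw [invTemp, temperature, if_neg hα.ne', mul_assoc]

lemma invTemp_rpow_mul (hκ : 0 < kB * t) (hα : 1 < α) {n : ℕ} (hn : 0 < n) :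
    invTemp kB α t n ^ α * n = ((kB * t) ^ α)⁻¹ := by
  have hn' : (0 : ℝ) < n := by exact_mod_cast hn
  rw [invTemp_eq hα, one_div, Real.inv_rpow (by positivity), Real.mul_rpow hκ.le (by positivity),
    ← Real.rpow_mul hn'.le, one_div_mul_cancel (by linarith), Real.rpow_one]
  field_simp

lemma tendsto_natCast_rpow {p : ℝ} (hp : 0 < p) :
    Tendsto (fun n : ℕ => (n : ℝ) ^ p) atTop atTop :=
  (tendsto_rpow_atTop hp).comp tendsto_natCast_atTop_atTop

lemma invTemp_pos (hκ : 0 < kB * t) (hα : 1 < α) {n : ℕ} (hn : 0 < n) :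
    0 < invTemp kB α t n := by
  have hn' : (0 : ℝ) < n := by exact_mod_cast hn
  rw [invTemp_eq hα]
  positivity

lemma tendsto_invTemp (hκ : 0 < kB * t) (hα : 1 < α) :
    Tendsto (invTemp kB α t) atTop (𝓝[>] 0) := by
  refine tendsto_nhdsWithin_iff.2 ⟨?_, ?_⟩
  · have h1 := ((tendsto_natCast_rpow (p := 1 / α)
      (by positivity)).const_mul_atTop hκ).const_div_atTop 1
    exact h1.congr fun n => (invTemp_eq hα kB t n).symm
  · filter_upwards [eventually_gt_atTop 0] with n hn
    exact invTemp_pos hκ hα hn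

lemma invTemp_one (kB t : ℝ) (n : ℕ) :
    invTemp kB 1 t n = Real.log n / (kB * t * n) := by
  rw [invTemp, temperature, if_pos rfl, ← mul_div_assoc, one_div_div, mul_assoc]

lemma tendsto_log_div_natCast : Tendsto (fun n : ℕ => Real.log n / n) atTop (𝓝 0) :=
  Real.isLittleO_log_id_atTop.tendsto_div_nhds_zero.comp tendsto_natCast_atTop_atTop

lemma tendsto_invTemp_one (hκ : 0 < kB * t) :
    Tendsto (invTemp kB 1 t) atTop (𝓝[>] 0) := by
  refine tendsto_nhdsWithin_iff.2 ⟨?_, ?_⟩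
  · have h1 := tendsto_log_div_natCast.div_const (kB * t)
    rw [zero_div] at h1
    refine h1.congr fun n => ?_
    rw [invTemp_one, div_div, mul_comm (n : ℝ)]
  · filter_upwards [eventually_gt_atTop 1] with n hn
    have hn' : (1 : ℝ) < n := by exact_mod_cast hn
    have := Real.log_pos hn'
    rw [invTemp_one]
    exact div_pos this (by positivity)

lemma tendsto_log_inv_invTemp (hκ : 0 < kB * t) (hα : 1 < α) :
    Tendsto (fun n : ℕ => Real.log (1 / invTemp kB α t n) / Real.log n) atTop (𝓝 (1 / α)) := by
  have h1 := (tendsto_log_natCast.const_div_atTop (Real.log (kB * t))).add_const (1 / α)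
  rw [zero_add] at h1
  refine h1.congr' ?_
  filter_upwards [eventually_gt_atTop 1] with n hn
  have hn' : (1 : ℝ) < n := by exact_mod_cast hn
  have hlog := Real.log_pos hn'
  rw [invTemp_eq hα, one_div_one_div, Real.log_mul hκ.ne' (by positivity),
    Real.log_rpow (by positivity)]
  field_simp

lemma tendsto_log_inv_invTemp_one (hκ : 0 < kB * t) :
    Tendsto (fun n : ℕ => Real.log (1 / invTemp kB 1 t n) / Real.log n) atTop (𝓝 1) := by
  have h2 : Tendsto (fun n : ℕ => Real.log (Real.log n) / Real.log n) atTop (𝓝 0) :=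
    Real.isLittleO_log_id_atTop.tendsto_div_nhds_zero.comp tendsto_log_natCast
  have h1 := ((tendsto_log_natCast.const_div_atTop (Real.log (kB * t))).add_const 1).sub h2
  rw [zero_add, sub_zero] at h1
  refine h1.congr' ?_
  filter_upwards [eventually_gt_atTop 1] with n hn
  have hn' : (1 : ℝ) < n := by exact_mod_cast hn
  have hlog := Real.log_pos hn'
  rw [invTemp_one, one_div_div, Real.log_div (by positivity) hlog.ne', Real.log_mul hκ.ne'
    (by positivity)]
  field_simp

variable {D : ℕ → ℝ} {L : ℝ}

lemma tendsto_div_natCast_of_rpow_mul (hκ : 0 < kB * t) (hα : 1 < α) {F : ℝ → ℝ} {ℓ : ℝ}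
    (hF : Tendsto (fun β => β ^ α * F β) (𝓝[>] 0) (𝓝 ℓ)) :
    Tendsto (fun n : ℕ => F (invTemp kB α t n) / n) atTop (𝓝 (ℓ * (kB * t) ^ α)) := by
  refine ((hF.comp (tendsto_invTemp hκ hα)).mul_const ((kB * t) ^ α)).congr' ?_
  filter_upwards [eventually_gt_atTop 0] with n hn
  have hn' : (0 : ℝ) < n := by exact_mod_cast hn
  have h2 := invTemp_rpow_mul hκ hα hn
  have hκα : 0 < (kB * t) ^ α := by positivity
  simp only [Function.comp]
  rw [eq_div_iff hn'.ne']
  calc _ = (invTemp kB α t n ^ α * n) * (kB * t) ^ α * F (invTemp kB α t n) := by ring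
    _ = _ := by rw [h2, inv_mul_cancel₀ hκα.ne', one_mul]

/-- The expected proportion of excited particles tends to `(t / t_c) ^ α`. -/
lemma IsSpectrum.tendsto_meanTotal_div (h : IsSpectrum D L α) (hκ : 0 < kB * t) (hα : 1 < α) :
    Tendsto (fun n : ℕ => meanTotal D (invTemp kB α t n) / n) atTop
      (𝓝 ((kB * t * spectralConst L α) ^ α)) := by
  have h1 := h.tendsto_rpow_mul_tsum 0 (by linarith)
  simp only [sub_zero, Real.rpow_zero, one_mul] at h1
  rw [← (spectralConst_rpow h.L_pos hα).1] at h1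
  rw [Real.mul_rpow hκ.le (spectralConst_pos h.L_pos hα.le).le, mul_comm]
  exact tendsto_div_natCast_of_rpow_mul hκ hα h1

/-- The expected proportion of excited particles tends to `t / t_c` when `α = 1`. -/
lemma IsSpectrum.tendsto_meanTotal_div_one (h : IsSpectrum D L 1) (hκ : 0 < kB * t) :
    Tendsto (fun n : ℕ => meanTotal D (invTemp kB 1 t n) / n) atTop
      (𝓝 (kB * t * spectralConst L 1)) := by
  have h1 := (((h.tendsto_rpow_mul_tsum_div_log 0 (by norm_num)).comp
    (tendsto_invTemp_one hκ)).mul (tendsto_log_inv_invTemp_one hκ)).mul_const (kB * t)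
  have hG : Real.Gamma (1 + 1) = 1 := by norm_num
  rw [hG, mul_one, mul_one, mul_comm L] at h1
  rw [spectralConst, if_pos rfl]
  refine h1.congr' ?_
  filter_upwards [eventually_gt_atTop 1,
    (tendsto_log_inv_nhdsGT.comp (tendsto_invTemp_one hκ)).eventually_gt_atTop 0] with n hn hl
  have hn' : (1 : ℝ) < n := by exact_mod_cast hn
  have hlog := Real.log_pos hn'
  have hl' : Real.log (1 / invTemp kB 1 t n) ≠ 0 := hl.ne'
  simp only [Function.comp, Real.rpow_zero, one_mul, Real.rpow_one]
  rw [← meanTotal, div_mul_div_cancel₀ hl']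
  rw [show invTemp kB 1 t n * meanTotal D (invTemp kB 1 t n)
    = Real.log n / (kB * t * n) * meanTotal D (invTemp kB 1 t n) by rw [← invTemp_one]]
  have : (kB * t) ≠ 0 := hκ.ne'
  field_simp
  exact mul_div_cancel_left₀ _ this

end temperature

lemma zeta_two : zeta 2 = Real.pi ^ 2 / 6 := by
  have h : riemannZeta ((2 : ℝ) : ℂ) = ((Real.pi ^ 2 / 6 : ℝ) : ℂ) := by
    push_cast
    exact riemannZeta_two
  rw [zeta, h, Complex.ofReal_re]

section variances

variable {kB t α : ℝ} {D : ℕ → ℝ} {L : ℝ}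

/-- The variance `∑ₖ k K(kβ)` of the number of excited particles is of order `n` for `α > 2`. -/
lemma IsSpectrum.tendsto_clusterSum_div (h : IsSpectrum D L α) (hκ : 0 < kB * t) (hα : 2 < α) :
    Tendsto (fun n : ℕ => (∑' k : ℕ, ((k : ℝ) + 1) *
      heatTrace D (((k : ℝ) + 1) * invTemp kB α t n)) / √(n : ℝ) ^ 2) atTop
      (𝓝 ((t / criticalT kB L α) ^ α * zeta (α - 1) / zeta α)) := by
  have hα1 : 1 < α := by linarith
  have h1 := h.tendsto_rpow_mul_tsum 1 (by linarith)
  simp only [Real.rpow_one] at h1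
  have h2 := tendsto_div_natCast_of_rpow_mul hκ hα1 h1
  have h3 := (zeta_pos hα1).ne'
  rw [div_criticalT, Real.mul_rpow hκ.le (spectralConst_pos h.L_pos hα1.le).le,
    (spectralConst_rpow h.L_pos hα1).1]
  convert h2 using 2
  · rw [Real.sq_sqrt (Nat.cast_nonneg _)]
  · field_simp

/-- At `α = 2` the sum `∑ₖ k K(kβ)` is of order `n log n`; the factor `1 / 2` comes from
`log (1 / β) ~ (log n) / 2`. -/
lemma IsSpectrum.tendsto_clusterSum_div_two (h : IsSpectrum D L 2) (hκ : 0 < kB * t) :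
    Tendsto (fun n : ℕ => (∑' k : ℕ, ((k : ℝ) + 1) *
      heatTrace D (((k : ℝ) + 1) * invTemp kB 2 t n)) / √((n : ℝ) * Real.log n) ^ 2) atTop
      (𝓝 (3 * (t / criticalT kB L 2) ^ 2 / Real.pi ^ 2)) := by
  have h1 := h.tendsto_rpow_mul_tsum_div_log 1 (by norm_num)
  simp only [Real.rpow_one, mul_div_assoc] at h1
  have h2 := (tendsto_div_natCast_of_rpow_mul hκ one_lt_two h1).mul
    (tendsto_log_inv_invTemp hκ one_lt_two)
  have hc := (spectralConst_rpow h.L_pos one_lt_two).1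
  rw [zeta_two, Real.rpow_two] at hc
  have hv : 3 * (t / criticalT kB L 2) ^ 2 / Real.pi ^ 2
      = L * Real.Gamma (2 + 1) * (kB * t) ^ (2 : ℝ) * (1 / 2) := by
    rw [div_criticalT, mul_pow, hc, Real.rpow_two]
    have := Real.pi_ne_zero
    field_simp
    ring
  rw [hv]
  refine h2.congr' ?_
  filter_upwards [eventually_gt_atTop 1, (tendsto_log_inv_nhdsGT.comp
    (tendsto_invTemp hκ one_lt_two)).eventually_gt_atTop 0] with n hn hl
  have hn' : (1 : ℝ) < n := by exact_mod_cast hn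
  have hlog := Real.log_pos hn'
  have hl' : Real.log (1 / invTemp kB 2 t n) ≠ 0 := hl.ne'
  rw [Real.sq_sqrt (by positivity)]
  generalize (∑' k : ℕ, ((k : ℝ) + 1) * heatTrace D (((k : ℝ) + 1) * invTemp kB 2 t n)) = S
  field_simp

lemma tendsto_rpow_mul_sqrt_pow_atTop (hκ : 0 < kB * t) (hα : 2 < α) :
    Tendsto (fun n : ℕ => invTemp kB α t n ^ α * invTemp kB α t n * √(n : ℝ) ^ 3) atTop
      atTop := by
  have hα0 : 0 < α := by linarith
  have hp : 0 < 1 / 2 - 1 / α := by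
    have : 1 / α < 1 / 2 := one_div_lt_one_div_of_lt two_pos hα
    linarith
  have hc : 0 < ((kB * t) ^ α)⁻¹ * (kB * t)⁻¹ := by positivity
  refine ((tendsto_natCast_rpow hp).const_mul_atTop hc).congr' ?_
  filter_upwards [eventually_gt_atTop 0] with n hn
  have hn' : (0 : ℝ) < n := by exact_mod_cast hn
  have h1 : √(n : ℝ) ^ 3 = n * √(n : ℝ) := by
    rw [pow_succ, Real.sq_sqrt hn'.le]
  rw [h1, ← invTemp_rpow_mul hκ (by linarith) hn, invTemp_eq (by linarith), Real.rpow_sub hn',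
    ← Real.sqrt_eq_rpow]
  field_simp

lemma tendsto_rpow_mul_sqrt_log_pow_atTop (hκ : 0 < kB * t) :
    Tendsto (fun n : ℕ => invTemp kB 2 t n ^ (2 : ℝ) * invTemp kB 2 t n *
      √((n : ℝ) * Real.log n) ^ 3) atTop atTop := by
  have hc : 0 < ((kB * t) ^ (2 : ℝ))⁻¹ * (kB * t)⁻¹ := by positivity
  have h1 := (tendsto_log_natCast.atTop_mul_atTop₀
    (Real.tendsto_sqrt_atTop.comp tendsto_log_natCast)).const_mul_atTop hc
  refine h1.congr' ?_
  filter_upwards [eventually_gt_atTop 1] with n hn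
  have hn' : (1 : ℝ) < n := by exact_mod_cast hn
  have hn0 : (0 : ℝ) < n := by linarith
  have hlog := Real.log_pos hn'
  have h2 : √((n : ℝ) * Real.log n) ^ 3 = n * Real.log n * (√(n : ℝ) * √(Real.log n)) := by
    rw [pow_succ, Real.sq_sqrt (by positivity), Real.sqrt_mul hn0.le]
  have h3 : √(n : ℝ) ≠ 0 := (Real.sqrt_pos.2 hn0).ne'
  rw [h2, ← invTemp_rpow_mul hκ one_lt_two (zero_lt_one.trans hn), invTemp_eq one_lt_two,
    ← Real.sqrt_eq_rpow]
  simp only [Function.comp]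
  field_simp

end variances

/-! ### The random series and the fluctuation theorem -/

/-- Independent exponential variables on the product space `ℕ → ℝ`. -/
lemma isExpSeq_infinitePi :
    IsExpSeq (fun (j : ℕ) (ω : ℕ → ℝ) => ω j) (Measure.infinitePi fun _ : ℕ => expMeasure 1) where
  meas j := measurable_pi_apply j
  indep := iIndepFun_infinitePi (X := fun _ x => x) fun _ => measurable_id
  law j := (measurePreserving_eval_infinitePi (fun _ : ℕ => expMeasure 1) j).hasLaw

section series

variable {Ω : Type*} [MeasurableSpace Ω] {P : Measure Ω}
  {X : ℕ → Ω → ℝ} {E : ℕ → ℝ} {L α : ℝ}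

/-- Exponential variables that are only almost everywhere measurable can be replaced by measurable
versions. -/
lemma exists_isExpSeq (hX : iIndepFun X P) (hlaw : ∀ j, HasLaw (X j) (expMeasure 1) P) :
    ∃ X' : ℕ → Ω → ℝ, IsExpSeq X' P ∧ ∀ j, X j =ᵐ[P] X' j := by
  have h := fun j => (hlaw j).aemeasurable
  exact ⟨fun j => (h j).mk, ⟨fun j => (h j).measurable_mk, hX.congr fun j => (h j).ae_eq_mk,
    fun j => (hlaw j).congr (h j).ae_eq_mk.symm⟩, fun j => (h j).ae_eq_mk⟩

/-- For `α < 2` the series defining `W` converges almost surely and in `L²`. -/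
lemma IsExpSeq.exists_isSeriesLimit [IsProbabilityMeasure P] {X' : ℕ → Ω → ℝ} (hX : IsExpSeq X' P)
    (hXX' : ∀ j, X j =ᵐ[P] X' j) (h : IsSpectrum (excitation E) L α) (hα : α < 2) :
    ∃ Z : Ω → ℝ, AEMeasurable Z P ∧ (∀ᵐ ω ∂P, Tendsto (fun m => ∑ j ∈ Finset.range m,
      (X' j ω - 1) / excitation E j) atTop (𝓝 (Z ω))) ∧
      IsSeriesLimit P E L α X fun ω => -(1 / spectralConst L α) * Z ω := by
  have hc := hX.isCentredSeq_div (excitation E)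
  have hs : Summable fun j => ∫ ω, ((X' j ω - 1) / excitation E j) ^ 2 ∂P := by
    simp_rw [hX.integral_div_sq]
    exact h.summable_inv_sq hα
  obtain ⟨Z, hZ⟩ := hc.exists_ae_tendsto hs
  have hZL := (hc.eLpNorm_lim_le (fun m => hs.sum_le_tsum (Finset.range m) fun j _ =>
    integral_nonneg fun ω => sq_nonneg _) hZ).1
  have hpart : ∀ᵐ ω ∂P, ∀ m, partialW E L α X m ω
      = -(1 / spectralConst L α) * ∑ j ∈ Finset.range m, (X' j ω - 1) / excitation E j := by
    filter_upwards [ae_all_iff.2 hXX'] with ω hω m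
    rw [partialW, neg_mul, ← mul_neg, ← Finset.sum_neg_distrib]
    congr 1
    refine Finset.sum_congr rfl fun j _ => ?_
    rw [hω j, excitation, ← neg_div, neg_sub]
  refine ⟨Z, hZL.aemeasurable, hZ, hZL.const_mul _, ?_, ?_⟩
  · filter_upwards [hZ, hpart] with ω h1 h2
    simp_rw [h2]
    exact h1.const_mul _
  · have h1 := ENNReal.Tendsto.const_mul (a := ‖-(1 / spectralConst L α)‖ₑ)
      (hc.tendsto_eLpNorm hs hZ) (Or.inr enorm_ne_top)
    rw [mul_zero] at h1
    refine h1.congr fun m => ?_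
    rw [← eLpNorm_const_smul]
    refine eLpNorm_congr_ae ?_
    filter_upwards [hpart] with ω h2
    simp only [Pi.smul_apply, Pi.sub_apply, smul_eq_mul, h2]
    ring

end series

end BoseGas

open BoseGas

theorem theorem2
    (E : ℕ → ℝ) (hE : Monotone E) (hgap : E 0 < E 1)
    (L α : ℝ) (hL : 0 < L) (hα : 1 ≤ α) (hWeyl : BoseGas.WeylLaw E L α)
    (kB t : ℝ) (hkB : 0 < kB) (ht : 0 < t) (htc : t < BoseGas.criticalT kB L α)
    {Ω : Type*} [MeasurableSpace Ω] (P : Measure Ω) [IsProbabilityMeasure P] :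
    -- the canonical Gibbs measure is well defined at every positive inverse temperature
    (∀ (n : ℕ) (β : ℝ), 0 < β → BoseGas.partitionFunction E n β ≠ ∞) ∧
    (α = 1 → ∀ X : ℕ → Ω → ℝ, iIndepFun X P → (∀ j, HasLaw (X j) (expMeasure 1) P) →
      ∃ W : Ω → ℝ, BoseGas.IsSeriesLimit P E L α X W ∧
        TendstoInDistribution
          (fun (n : ℕ) (c : BoseGas.Config n) =>
            BoseGas.centeredN0 E n (BoseGas.invTemp kB α t n) c / ((n : ℝ) / Real.log n))
          atTop (fun ω => t / BoseGas.criticalT kB L α * W ω)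
          (fun n => BoseGas.gibbsMeasure E n (BoseGas.invTemp kB α t n)) P) ∧
    (1 < α → α < 2 → ∀ X : ℕ → Ω → ℝ, iIndepFun X P → (∀ j, HasLaw (X j) (expMeasure 1) P) →
      ∃ W : Ω → ℝ, BoseGas.IsSeriesLimit P E L α X W ∧
        TendstoInDistribution
          (fun (n : ℕ) (c : BoseGas.Config n) =>
            BoseGas.centeredN0 E n (BoseGas.invTemp kB α t n) c / (n : ℝ) ^ (1 / α))
          atTop (fun ω => t / BoseGas.criticalT kB L α * W ω)
          (fun n => BoseGas.gibbsMeasure E n (BoseGas.invTemp kB α t n)) P) ∧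
    (α = 2 →
      TendstoInDistribution
        (fun (n : ℕ) (c : BoseGas.Config n) =>
          BoseGas.centeredN0 E n (BoseGas.invTemp kB α t n) c / √((n : ℝ) * Real.log n))
        atTop (fun x : ℝ => x)
        (fun n => BoseGas.gibbsMeasure E n (BoseGas.invTemp kB α t n))
        (gaussianReal 0
          (Real.toNNReal (3 * (t / BoseGas.criticalT kB L α) ^ 2 / Real.pi ^ 2)))) ∧
    (2 < α →
      TendstoInDistribution
        (fun (n : ℕ) (c : BoseGas.Config n) =>
          BoseGas.centeredN0 E n (BoseGas.invTemp kB α t n) c / √(n : ℝ))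
        atTop (fun x : ℝ => x)
        (fun n => BoseGas.gibbsMeasure E n (BoseGas.invTemp kB α t n))
        (gaussianReal 0
          (Real.toNNReal ((t / BoseGas.criticalT kB L α) ^ α * BoseGas.zeta (α - 1)
            / BoseGas.zeta α)))) := by
  have h : IsSpectrum (excitation E) L α := isSpectrum_excitation hE hgap hL hα hWeyl
  have hX₀ := isExpSeq_infinitePi
  have hκ : 0 < kB * t := mul_pos hkB ht
  have hc := spectralConst_pos hL hα
  have hr0 : 0 < kB * t * spectralConst L α := mul_pos hκ hc
  have hr : kB * t * spectralConst L α < 1 := by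
    rw [criticalT, lt_div_iff₀ (mul_pos hkB hc)] at htc
    linarith
  have hcoef : ∀ Z : Ω → ℝ, (fun ω => t / criticalT kB L α * (-(1 / spectralConst L α) * Z ω))
      = fun ω => -(kB * t) * Z ω := fun Z => by
    ext ω
    rw [div_criticalT]
    field_simp
  refine ⟨fun n β hβ => hX₀.partitionFunction_ne_top hβ h n, ?_, ?_, ?_, ?_⟩
  · rintro rfl X hX hlaw
    obtain ⟨X', hX', hXX'⟩ := exists_isExpSeq hX hlaw
    obtain ⟨Z, hZm, hZ, hW⟩ := hX'.exists_isSeriesLimit hXX' h one_lt_two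
    refine ⟨_, hW, ?_⟩
    rw [hcoef]
    refine hX'.tendstoInDistribution_series h one_lt_two (tendsto_invTemp_one hκ) ?_ ?_ ?_ hr
      (h.tendsto_meanTotal_div_one hκ) hZm hZ
    · filter_upwards [eventually_gt_atTop 1] with n hn
      have hn' : (1 : ℝ) < n := by exact_mod_cast hn
      have := Real.log_pos hn'
      positivity
    · filter_upwards [eventually_gt_atTop 1] with n hn
      have hn' : (1 : ℝ) < n := by exact_mod_cast hn
      have := Real.log_pos hn'
      rw [invTemp_one]
      field_simp
    · refine (tendsto_log_natCast.const_div_atTop 1).congr' ?_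
      filter_upwards [eventually_gt_atTop 0] with n hn
      have hn' : (0 : ℝ) < n := by exact_mod_cast hn
      field_simp
  · intro hα1 hα2 X hX hlaw
    obtain ⟨X', hX', hXX'⟩ := exists_isExpSeq hX hlaw
    obtain ⟨Z, hZm, hZ, hW⟩ := hX'.exists_isSeriesLimit hXX' h hα2
    refine ⟨_, hW, ?_⟩
    rw [hcoef]
    refine hX'.tendstoInDistribution_series h hα2 (tendsto_invTemp hκ hα1) ?_ ?_ ?_
      (Real.rpow_lt_one hr0.le hr (by linarith)) (h.tendsto_meanTotal_div hκ hα1) hZm hZ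
    · filter_upwards [eventually_gt_atTop 0] with n hn
      have hn' : (0 : ℝ) < n := by exact_mod_cast hn
      positivity
    · filter_upwards [eventually_gt_atTop 0] with n hn
      have hn' : (0 : ℝ) < n := by exact_mod_cast hn
      rw [invTemp_eq hα1]
      field_simp
    · have hp : 0 < 1 - 1 / α := by
        have : 1 / α < 1 := by rw [div_lt_one (by linarith)]; exact hα1
        linarith
      refine ((tendsto_natCast_rpow hp).const_div_atTop 1).congr' ?_
      filter_upwards [eventually_gt_atTop 0] with n hn
      have hn' : (0 : ℝ) < n := by exact_mod_cast hn
      rw [Real.rpow_sub hn', Real.rpow_one, one_div_div]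
  · rintro rfl
    refine hX₀.tendstoInDistribution_gaussian h le_rfl
      ((tendsto_invTemp hκ one_lt_two).eventually self_mem_nhdsWithin) ?_ ?_
      (Real.rpow_lt_one hr0.le hr two_pos) (h.tendsto_meanTotal_div hκ one_lt_two) (by positivity)
      (h.tendsto_clusterSum_div_two hκ) (tendsto_rpow_mul_sqrt_log_pow_atTop hκ)
    · filter_upwards [eventually_gt_atTop 1] with n hn
      have hn' : (1 : ℝ) < n := by exact_mod_cast hn
      have := Real.log_pos hn'
      positivity
    · have h1 := tendsto_log_div_natCast.sqrt
      rw [Real.sqrt_zero] at h1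
      refine h1.congr' ?_
      filter_upwards [eventually_gt_atTop 0] with n hn
      have hn' : (0 : ℝ) < n := by exact_mod_cast hn
      have h2 : √(n : ℝ) ≠ 0 := (Real.sqrt_pos.2 hn').ne'
      rw [Real.sqrt_mul hn'.le, Real.sqrt_div' _ hn'.le, div_eq_div_iff h2 hn'.ne', mul_right_comm,
        Real.mul_self_sqrt hn'.le, mul_comm]
  · intro hα2
    have hα1 : 1 < α := by linarith
    refine hX₀.tendstoInDistribution_gaussian h hα2.le
      ((tendsto_invTemp hκ hα1).eventually self_mem_nhdsWithin) ?_ ?_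
      (Real.rpow_lt_one hr0.le hr (by linarith)) (h.tendsto_meanTotal_div hκ hα1) ?_
      (h.tendsto_clusterSum_div hκ hα2) (tendsto_rpow_mul_sqrt_pow_atTop hκ hα2)
    · filter_upwards [eventually_gt_atTop 0] with n hn
      have hn' : (0 : ℝ) < n := by exact_mod_cast hn
      positivity
    · refine ((Real.tendsto_sqrt_atTop.comp tendsto_natCast_atTop_atTop).const_div_atTop
        1).congr fun n => ?_
      simp only [Function.comp]
      rw [Real.sqrt_div_self']
    · have h1 := zeta_pos hα1
      have h2 := zeta_pos (p := α - 1) (by linarith)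
      have h3 : 0 < t / criticalT kB L α := by
        rw [div_criticalT]; exact hr0
      positivity
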